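/- Notation. $\mathbb R_+=(0,\infty)$. A weight on $\mathbb R_+$ (respectively on $\mathbb R_+^2$) is a non-negative function that is locally integrable on $[0,\infty)$ (respectively on $[0,\infty)^2$). For a measurable $g$ on $\mathbb R$, $g^*(t)=\inf\{\sigma\ge 0: |\{|g|>\sigma\}|\le t\}$. For a measurable $f:\mathbb R^2\to\mathbb R$ let $f_y^*(x,\cdot)$ be the decreasing rearrangement of $f(x,\cdot)$ and $f_{yx}^*(s,t)=(f_y^*(\cdot,t))^*(s)$. For a weight $w$ on $\mathbb R_+^2$, $\Lambda_2^p(w)$ is the set of measurable $f:\mathbb R^2\to\mathbb R$ (modulo a.e. equality) with $$\|f\|_{\Lambda_2^p(w)}=\Big(\int_{\mathbb R_+^2} f_{yx}^*(s,t)^p\,w(s,t)\,ds\,dt\Big)^{1/p}<\infty .$$ It is called normable if it is a linear space carrying a norm equivalent to $\|\cdot\|_{\Lambda_2^p(w)}$. Let $S^2f(s,t)=\frac1{st}\int_0^s\int_0^t f(\sigma,\tau)\,d\tau\,d\sigma$, and let $L^p_{\rm dec}(\mathbb R_+^2,w)$ be the cone of non-negative functions in $L^p(\mathbb R_+^2,w)$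 that are decreasing (non-increasing) in each variable. We write $w\in B_p^{(2)}$ (respectively $w\in B_{p,\infty}^{(2)}$) if $S^2$ is bounded from $L^p_{\rm dec}(\mathbb R_+^2,w)$ to $L^p(\mathbb R_+^2,w)$ (respectively to weak $L^{p,\infty}(\mathbb R_+^2,w)$). For a weight $v$ on $\mathbb R_+$, $v\in B_p$ means that there is $C$ with $r^p\int_r^\infty v(x)x^{-p}\,dx\le C\int_0^r v(x)\,dx$ for all $r>0$, and $v\in B_{1,\infty}$ means that there is $C$ with $\frac1r\int_0^r v\le \frac Cs\int_0^s v$ for all $0<s\le r$. Let $\Delta_d$ be the family of all $D\subset\mathbb R_+^2$ such that $\chi_D$ is decreasing in each variable. Quotients are taken in $[0,\infty]$ with $x/0=\infty$ for $x>0$; in the suprema over $D$ below, the sets $D$ giving $0/0$ or $\infty/\infty$ are disregarded. Theorem 2.8. Let $p\ge 1$. 1. If $w$ is a weight on $\mathbb R_+^2$ that is not a.e. zero and $w\in B_p^{(2)}$, then $\Lambda_2^p(w)$ is normable. 2. For every weight $w$ on $\mathbb R_+^2$, $w\in B_1^{(2)}$ if and only if $$\sup_{D\in\Delta_d}\frac{\int_{\mathbb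 R_+^2}S^2(\chi_D)(s,t)\,w(s,t)\,ds\,dt}{\int_D w(s,t)\,ds\,dt}<\infty .$$ 3. If $w(s,t)=u(s)v(t)$, where $u,v$ are weights on $\mathbb R_+$, neither of them a.e. zero, then (both sides possibly infinite) $$\sup_{D\in\Delta_d}\frac{\int_{\mathbb R_+^2}S^2(\chi_D)(s,t)\,w(s,t)\,ds\,dt}{\int_D w(s,t)\,ds\,dt}=\left(1+\sup_{a>0}\frac{a\int_a^\infty \frac{u(s)}s\,ds}{\int_0^a u(s)\,ds}\right)\left(1+\sup_{b>0}\frac{b\int_b^\infty \frac{v(t)}t\,dt}{\int_0^b v(t)\,dt}\right).$$ 4. If $w(s,t)=u(s)v(t)$, where $u,v$ are weights on $\mathbb R_+$, neither of them a.e. zero, then $w\in B_p^{(2)}$ if and only if $u\in B_p$ and $v\in B_p$. 5. $1\notin B_{1,\infty}^{(2)}$, although $1\in B_{1,\infty}$. -/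

import Mathlib

open MeasureTheory Set
open scoped ENNReal NNReal

noncomputable section

namespace Lorentz2

/-- The open first quadrant `(0,∞) × (0,∞)`. -/
def quadrant : Set (ℝ × ℝ) := Ioi 0 ×ˢ Ioi 0

/-- A weight on the half-line: a non-negative function that is locally integrable on `[0,∞)`;
in particular its integral over `(0,r)` is finite for every `r`. -/
def IsWeight (u : ℝ → ℝ≥0) : Prop :=
  LocallyIntegrableOn (fun s => (u s : ℝ)) (Ici 0) volume

/-- A weight on the quadrant: a non-negative function, locally integrable on `[0,∞) × [0,∞)`. -/
def IsWeight₂ (w : ℝ × ℝ → ℝ≥0) : Prop :=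
  LocallyIntegrableOn (fun z => (w z : ℝ)) (Ici 0 ×ˢ Ici 0) volume

/-- The product weight `(s,t) ↦ u(s) v(t)`. -/
def prodWeight (u v : ℝ → ℝ≥0) : ℝ × ℝ → ℝ≥0 := fun z => u z.1 * v z.2

/-- Decreasing rearrangement `g^*(t) = inf {σ : |{g > σ}| ≤ t}` of a `[0,∞]`-valued function
on the line (apply it to the modulus of a real-valued function). -/
def rearr (g : ℝ → ℝ≥0∞) (t : ℝ) : ℝ≥0∞ :=
  sInf {σ : ℝ≥0∞ | volume {x : ℝ | σ < g x} ≤ ENNReal.ofReal t}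

/-- Rearrangement of `f` in the second variable, with the first variable `x` fixed. -/
def rearrY (f : ℝ × ℝ → ℝ) (x t : ℝ) : ℝ≥0∞ := rearr (fun y => ‖f (x, y)‖ₑ) t

/-- The multivariate rearrangement: first in the second variable, then in the first one. -/
def rearrYX (f : ℝ × ℝ → ℝ) (z : ℝ × ℝ) : ℝ≥0∞ := rearr (fun x => rearrY f x z.2) z.1

/-- The (quasi-)norm of `L^p` on the quadrant with respect to `w(s,t) ds dt`. -/
def lpNorm (p : ℝ) (w : ℝ × ℝ → ℝ≥0) (g : ℝ × ℝ → ℝ≥0∞) : ℝ≥0∞ :=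
  (∫⁻ z in quadrant, g z ^ p * (w z : ℝ≥0∞)) ^ (1 / p)

/-- The weak `L^{p,∞}` (quasi-)norm on the quadrant with respect to `w(s,t) ds dt`. -/
def weakLpNorm (p : ℝ) (w : ℝ × ℝ → ℝ≥0) (g : ℝ × ℝ → ℝ≥0∞) : ℝ≥0∞ :=
  ⨆ l : ℝ≥0, (l : ℝ≥0∞) *
    (∫⁻ z in {z ∈ quadrant | (l : ℝ≥0∞) < g z}, (w z : ℝ≥0∞)) ^ (1 / p)

/-- The functional defining the two-dimensional Lorentz space. -/
def lorentzNorm (p : ℝ) (w : ℝ × ℝ → ℝ≥0) (f : ℝ × ℝ → ℝ) : ℝ≥0∞ :=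
  lpNorm p w (rearrYX f)

/-- The two-dimensional Lorentz space, formed by the (classes modulo a.e. equality of) measurable
functions on the plane with finite `lorentzNorm`, is normable: it is a linear space and carries
a norm that is equivalent to `lorentzNorm`. -/
def LorentzNormable (p : ℝ) (w : ℝ × ℝ → ℝ≥0) : Prop :=
  ∃ V : Submodule ℝ ((ℝ × ℝ) →ₘ[volume] ℝ),
    (∀ f : (ℝ × ℝ) →ₘ[volume] ℝ, f ∈ V ↔ lorentzNorm p w f < ∞) ∧
    ∃ N : Seminorm ℝ V, (∀ f : V, N f = 0 → f = 0) ∧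
      ∃ A B : ℝ≥0, 0 < A ∧ 0 < B ∧ ∀ f : V,
        (A : ℝ≥0∞) * lorentzNorm p w (f : (ℝ × ℝ) →ₘ[volume] ℝ) ≤ ENNReal.ofReal (N f) ∧
        ENNReal.ofReal (N f) ≤ (B : ℝ≥0∞) * lorentzNorm p w (f : (ℝ × ℝ) →ₘ[volume] ℝ)

/-- The two-dimensional Hardy operator
`S²f(s,t) = (st)⁻¹ ∫_0^s ∫_0^t f(σ,τ) dτ dσ` on non-negative functions. -/
def hardy₂ (f : ℝ × ℝ → ℝ≥0∞) (z : ℝ × ℝ) : ℝ≥0∞ :=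
  (ENNReal.ofReal (z.1 * z.2))⁻¹ * ∫⁻ σ in Ioc 0 z.1, ∫⁻ τ in Ioc 0 z.2, f (σ, τ)

/-- The cone of non-negative functions in `L^p(w)` on the quadrant that are decreasing in each
variable separately (equivalently, antitone for the componentwise order). Such functions are
automatically Lebesgue measurable on the quadrant. -/
def IsDecLp (p : ℝ) (w : ℝ × ℝ → ℝ≥0) (f : ℝ × ℝ → ℝ≥0) : Prop :=
  AntitoneOn f quadrant ∧ lpNorm p w (fun z => (f z : ℝ≥0∞)) < ∞

/-- `w ∈ B_p^{(2)}`: the Hardy operator is bounded from the decreasing cone to `L^p(w)`. -/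
def MemB₂ (p : ℝ) (w : ℝ × ℝ → ℝ≥0) : Prop :=
  ∃ C : ℝ≥0, ∀ f : ℝ × ℝ → ℝ≥0, IsDecLp p w f →
    lpNorm p w (hardy₂ fun z => (f z : ℝ≥0∞)) ≤
      (C : ℝ≥0∞) * lpNorm p w (fun z => (f z : ℝ≥0∞))

/-- `w ∈ B_{p,∞}^{(2)}`: the Hardy operator is bounded from the decreasing cone to
`L^{p,∞}(w)`. -/
def MemB₂Weak (p : ℝ) (w : ℝ × ℝ → ℝ≥0) : Prop :=
  ∃ C : ℝ≥0, ∀ f : ℝ × ℝ → ℝ≥0, IsDecLp p w f →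
    weakLpNorm p w (hardy₂ fun z => (f z : ℝ≥0∞)) ≤
      (C : ℝ≥0∞) * lpNorm p w (fun z => (f z : ℝ≥0∞))

/-- `v ∈ B_p`: `r^p ∫_r^∞ v(x) x^{-p} dx ≤ C ∫_0^r v(x) dx` for all `r > 0`. -/
def MemB (p : ℝ) (v : ℝ → ℝ≥0) : Prop :=
  ∃ C : ℝ≥0, ∀ r : ℝ, 0 < r →
    ENNReal.ofReal (r ^ p) * ∫⁻ x in Ioi r, ENNReal.ofReal ((v x : ℝ) / x ^ p) ≤
      (C : ℝ≥0∞) * ∫⁻ x in Ioc 0 r, (v x : ℝ≥0∞)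

/-- `v ∈ B_{1,∞}`: `r⁻¹ ∫_0^r v ≤ C s⁻¹ ∫_0^s v` for all `0 < s ≤ r`. -/
def MemBOneWeak (v : ℝ → ℝ≥0) : Prop :=
  ∃ C : ℝ≥0, ∀ s r : ℝ, 0 < s → s ≤ r →
    ENNReal.ofReal (1 / r) * ∫⁻ x in Ioc 0 r, (v x : ℝ≥0∞) ≤
      (C : ℝ≥0∞) * (ENNReal.ofReal (1 / s) * ∫⁻ x in Ioc 0 s, (v x : ℝ≥0∞))

/-- A decreasing set: a subset of the quadrant whose characteristic function is decreasing in
each variable on the quadrant. Such sets are automatically Lebesgue measurable. -/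
def IsDecSet (D : Set (ℝ × ℝ)) : Prop :=
  D ⊆ quadrant ∧ AntitoneOn (D.indicator (1 : ℝ × ℝ → ℝ≥0)) quadrant

/-- The supremum over all decreasing sets `D` of `∫ S²(χ_D) w / ∫_D w`, in `[0,∞]`.
Here `x / 0 = ∞` for `x > 0` and `0 / 0 = ∞ / ∞ = 0`, so that sets with `0 / 0` or with infinite
`w`-measure do not contribute. -/
def decSup (w : ℝ × ℝ → ℝ≥0) : ℝ≥0∞ :=
  ⨆ (D : Set (ℝ × ℝ)) (_ : IsDecSet D),
    (∫⁻ z in quadrant, hardy₂ (D.indicator 1) z * (w z : ℝ≥0∞)) / ∫⁻ z in D, (w z : ℝ≥0∞)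

/-- The quantity `sup_{a>0} (a ∫_a^∞ u(s)/s ds) / ∫_0^a u(s) ds`, in `[0,∞]`, with
`x / 0 = ∞` for `x > 0`. -/
def tailSup (u : ℝ → ℝ≥0) : ℝ≥0∞ :=
  ⨆ (a : ℝ) (_ : 0 < a),
    (ENNReal.ofReal a * ∫⁻ s in Ioi a, ENNReal.ofReal ((u s : ℝ) / s)) /
      ∫⁻ s in Ioc 0 a, (u s : ℝ≥0∞)

end Lorentz2

end

/-!
Why the theorem is true.

*Normability.* The functional `f ↦ ‖f_yx^*‖_{L^p(w)}` need not be subadditive, and neither is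
`S²(f_yx^*)`. The maximal function `maxRearr f`, that is
`(st)⁻¹ sup_{|E| ≤ s} ∫_E sup_{|F| ≤ t} ∫_F |f(x,y)| dy dx`, is subadditive, and it satisfies
`f_yx^* ≤ maxRearr f ≤ S²(f_yx^*)` (`rearrYX_le_maxRearr`, `maxRearr_le_hardy₂`). If
`w ∈ B_p^{(2)}`, then `‖S²(f_yx^*)‖ ≤ C ‖f_yx^*‖`, so `f ↦ ‖maxRearr f‖_{L^p(w)}` is an equivalent
norm. The inner and outer suprema are written as `∫_0^t g^* = inf_σ (t σ + ∫ (g - σ)₊)` (`kFun`),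
which makes subadditivity and measurability immediate.

*The endpoint `p = 1`.* By Tonelli, `∫ S²f w = ∫ f w'` with `w'` the transpose of `S²` applied
to `w`. Both sides of `∫ f w' ≤ C ∫ f w` are integrals over the superlevel sets of `f`, which are
decreasing sets when `f` is decreasing, so that testing on characteristic functions suffices.

*Product weights.* The operator `S²` is the composition of two one-dimensional Hardy operators, and
applying one of them keeps a function decreasing in the other variable; hence one-dimensional
bounds multiply (`lintegral_hardy₂_prodWeight_le`). For `p = 1` the one-dimensional bound on
decreasing functions follows from the intervals `(0,r]`, with constant `1 + tailSup`; for general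
`p` it is the Ariño–Muckenhoupt theorem (`MemB.exists_hardy_bound`), which is proved by
showing that `B_p` improves the growth of `∫_0^r u` and by summing the dilations in
`S h (s) ≤ ∑ 2^{-k-1} h(2^{-k-1} s)`. Conversely, rectangles `(0,a] × (0,b]` are decreasing sets on
which everything factorizes.

*The constant weight.* The Hardy transform of the unit square is of size `1/(st)`, whose superlevel
sets have measure `≈ l⁻¹ log l⁻¹`.
-/

noncomputable section

namespace Lorentz2

/-! ### Monotone functions on the quadrant and layer-cake comparison -/

theorem measurableSet_quadrant : MeasurableSet quadrant :=
  measurableSet_Ioi.prod measurableSet_Ioi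

theorem ordConnected_quadrant : quadrant.OrdConnected :=
  ⟨fun _ hx _ _ _ hz => ⟨lt_of_lt_of_le hx.1 hz.1.1, lt_of_lt_of_le hx.2 hz.1.2⟩⟩

theorem volume_restrict_quadrant :
    (volume : Measure (ℝ × ℝ)).restrict quadrant =
      (volume.restrict (Ioi (0 : ℝ))).prod (volume.restrict (Ioi (0 : ℝ))) := by
  rw [quadrant, Measure.volume_eq_prod, Measure.prod_restrict]

/-- Mathlib proves this for `Fin 2 → ℝ`; the statement is transported along the order
isomorphism with `ℝ × ℝ`. -/
theorem nullMeasurableSet_of_ordConnected {E : Set (ℝ × ℝ)} (hE : E.OrdConnected) :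
    NullMeasurableSet E volume := by
  have h1 : (OrderIso.finTwoArrowIso ℝ ⁻¹' E).OrdConnected :=
    hE.preimage_mono (OrderIso.finTwoArrowIso ℝ).monotone
  have h2 := h1.nullMeasurableSet.preimage
    (volume_preserving_finTwoArrow ℝ).symm.quasiMeasurePreserving
  have h3 : (MeasurableEquiv.finTwoArrow : (Fin 2 → ℝ) ≃ᵐ ℝ × ℝ).symm ⁻¹'
      (OrderIso.finTwoArrowIso ℝ ⁻¹' E) = E := by
    ext z
    exact Iff.rfl
  rwa [h3] at h2

theorem aemeasurable_quadrant_of_ordConnected {f : ℝ × ℝ → ℝ≥0∞}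
    (hf : ∀ c, (quadrant ∩ {z | c < f z}).OrdConnected) :
    AEMeasurable f (volume.restrict quadrant) := by
  refine NullMeasurable.aemeasurable ?_
  refine @measurable_of_Ioi ℝ≥0∞ (NullMeasurableSpace (ℝ × ℝ) (volume.restrict quadrant))
    _ _ _ _ _ _ _ f fun c => ?_
  have h1 : NullMeasurableSet (quadrant ∩ {z | c < f z}) (volume.restrict quadrant) :=
    (nullMeasurableSet_of_ordConnected (hf c)).mono_ac
      (Measure.absolutelyContinuous_of_le Measure.restrict_le_self)
  refine h1.congr ?_
  filter_upwards [ae_restrict_mem measurableSet_quadrant] with z hz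
  exact propext ⟨fun h => h.2, fun h => ⟨hz, h⟩⟩

theorem aemeasurable_of_antitoneOn_quadrant {f : ℝ × ℝ → ℝ≥0∞} (hf : AntitoneOn f quadrant) :
    AEMeasurable f (volume.restrict quadrant) := by
  refine aemeasurable_quadrant_of_ordConnected fun c => ⟨fun x hx y hy z hz => ?_⟩
  have hzq := ordConnected_quadrant.out hx.1 hy.1 hz
  exact ⟨hzq, lt_of_lt_of_le hy.2 (hf hzq hy.1 hz.2)⟩

theorem volume_ofReal_lt (a : ℝ≥0∞) :
    volume.restrict (Ioi (0 : ℝ)) {l | ENNReal.ofReal l < a} = a := by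
  rw [Measure.restrict_apply (measurableSet_lt ENNReal.measurable_ofReal measurable_const)]
  rcases eq_or_ne a ∞ with rfl | ha
  · have : {l : ℝ | ENNReal.ofReal l < ∞} ∩ Ioi 0 = Ioi 0 := by
      ext l; simp
    rw [this, Real.volume_Ioi]
  · have : {l : ℝ | ENNReal.ofReal l < a} ∩ Ioi 0 = Ioo 0 a.toReal := by
      ext l
      simp only [mem_inter_iff, mem_ofPred_eq, mem_Ioi, mem_Ioo]
      constructor
      · rintro ⟨h1, h2⟩
        exact ⟨h2, (ENNReal.ofReal_lt_iff_lt_toReal h2.le ha).1 h1⟩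
      · rintro ⟨h1, h2⟩
        exact ⟨(ENNReal.ofReal_lt_iff_lt_toReal h1.le ha).2 h2, h1⟩
    rw [this, Real.volume_Ioo, sub_zero, ENNReal.ofReal_toReal ha]

/-- The layer-cake formula for `[0,∞]`-valued functions. -/
theorem lintegral_eq_lintegral_measure_lt {α : Type*} [MeasurableSpace α] (μ : Measure α)
    [SFinite μ] {h : α → ℝ≥0∞} (hh : AEMeasurable h μ) :
    ∫⁻ x, h x ∂μ = ∫⁻ l in Ioi (0 : ℝ), μ {x | ENNReal.ofReal l < h x} := by
  wlog hm : Measurable h generalizing h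
  · have h1 := this hh.measurable_mk.aemeasurable hh.measurable_mk
    rw [lintegral_congr_ae hh.ae_eq_mk, h1]
    refine lintegral_congr fun l => measure_congr ?_
    filter_upwards [hh.ae_eq_mk] with x hx
    exact propext (by change _ < _ ↔ _ < _; rw [hx])
  have hS : MeasurableSet {q : α × ℝ | ENNReal.ofReal q.2 < h q.1} :=
    measurableSet_lt (ENNReal.measurable_ofReal.comp measurable_snd) (hm.comp measurable_fst)
  calc ∫⁻ x, h x ∂μ
      = ∫⁻ x, (volume.restrict (Ioi (0 : ℝ))) (Prod.mk x ⁻¹'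
          {q : α × ℝ | ENNReal.ofReal q.2 < h q.1}) ∂μ :=
        lintegral_congr fun x => (volume_ofReal_lt (h x)).symm
    _ = (μ.prod (volume.restrict (Ioi (0 : ℝ)))) {q : α × ℝ | ENNReal.ofReal q.2 < h q.1} :=
        (Measure.prod_apply hS).symm
    _ = _ := Measure.prod_apply_symm hS

theorem antitone_measure_lt {α : Type*} [MeasurableSpace α] (μ : Measure α) (h : α → ℝ≥0∞) :
    Antitone fun l : ℝ => μ {x | ENNReal.ofReal l < h x} := fun _ _ hab =>
  measure_mono fun _ hx => lt_of_le_of_lt (ENNReal.ofReal_le_ofReal hab) hx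

/-- Integrals of a function against two measures are compared through its superlevel sets. -/
theorem lintegral_le_of_measure_lt_le {α : Type*} [MeasurableSpace α] {μ ν : Measure α}
    [SFinite μ] [SFinite ν] {C : ℝ≥0∞} {h : α → ℝ≥0∞} (hμ : AEMeasurable h μ)
    (hν : AEMeasurable h ν)
    (H : ∀ l : ℝ, 0 < l → μ {x | ENNReal.ofReal l < h x} ≤ C * ν {x | ENNReal.ofReal l < h x}) :
    ∫⁻ x, h x ∂μ ≤ C * ∫⁻ x, h x ∂ν := by
  rw [lintegral_eq_lintegral_measure_lt μ hμ, lintegral_eq_lintegral_measure_lt ν hν,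
    ← lintegral_const_mul _ (antitone_measure_lt ν h).measurable]
  exact setLIntegral_mono' measurableSet_Ioi fun l hl => H l hl

/-- An initial segment of `(0,∞)` is the directed union of countably many intervals `(0,r]`. -/
theorem measure_initial_segment_le {μ ν : Measure ℝ} {C : ℝ≥0∞}
    (H : ∀ r : ℝ, 0 < r → μ (Ioc 0 r) ≤ C * ν (Ioc 0 r)) {I : Set ℝ} (hI : I ⊆ Ioi 0)
    (hI' : ∀ x ∈ I, ∀ y, 0 < y → y ≤ x → y ∈ I) : μ I ≤ C * ν I := by
  by_cases hmax : ∃ r ∈ I, ∀ x ∈ I, x ≤ r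
  · obtain ⟨r, hr, hr'⟩ := hmax
    have : I = Ioc 0 r := by
      ext x
      exact ⟨fun hx => ⟨hI hx, hr' x hx⟩, fun hx => hI' r hr x hx.1 hx.2⟩
    rw [this]
    exact H r (hI hr)
  -- Without a largest element, every point lies below a rational point of the segment.
  · push Not at hmax
    have hU : I = ⋃ q ∈ {q : ℚ | (q : ℝ) ∈ I}, Ioc (0 : ℝ) q := by
      ext x
      simp only [mem_iUnion, mem_ofPred_eq, mem_Ioc, exists_prop]
      constructor
      · intro hx
        obtain ⟨y, hy, hxy⟩ := hmax x hx
        obtain ⟨q, hq1, hq2⟩ := exists_rat_btwn hxy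
        exact ⟨q, hI' y hy q ((hI hx).trans hq1) hq2.le, hI hx, hq1.le⟩
      · rintro ⟨q, hq, hx, hxq⟩
        exact hI' q hq x hx hxq
    have hm := measure_biUnion_eq_iSup (μ := μ) (s := fun q : ℚ => Ioc (0 : ℝ) q)
      (to_countable {q : ℚ | (q : ℝ) ∈ I}) (by
        intro a ha b hb
        rcases le_total a b with hab | hab
        · exact ⟨b, hb, Ioc_subset_Ioc_right (by exact_mod_cast hab), subset_rfl⟩
        · exact ⟨a, ha, subset_rfl, Ioc_subset_Ioc_right (by exact_mod_cast hab)⟩)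
    conv_lhs => rw [hU]
    rw [hm]
    refine iSup₂_le fun q hq => (H q (hI hq)).trans ?_
    gcongr
    exact fun x hx => hI' q hq x hx.1 hx.2

/-- Two measures that are comparable on the intervals `(0,r]` are comparable on decreasing
functions. -/
theorem lintegral_le_of_measure_Ioc_le {μ ν : Measure ℝ} [SFinite μ] [SFinite ν] {C : ℝ≥0∞}
    (H : ∀ r : ℝ, 0 < r → μ (Ioc 0 r) ≤ C * ν (Ioc 0 r)) {h : ℝ → ℝ≥0∞}
    (hh : AntitoneOn h (Ioi 0)) :
    ∫⁻ x in Ioi 0, h x ∂μ ≤ C * ∫⁻ x in Ioi 0, h x ∂ν := by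
  have key : ∀ (ρ : Measure ℝ) (l : ℝ), ρ.restrict (Ioi 0) {x | ENNReal.ofReal l < h x} =
      ρ ({x | ENNReal.ofReal l < h x} ∩ Ioi 0) := fun ρ l =>
    Measure.restrict_apply' measurableSet_Ioi
  refine lintegral_le_of_measure_lt_le (aemeasurable_restrict_of_antitoneOn measurableSet_Ioi hh)
    (aemeasurable_restrict_of_antitoneOn measurableSet_Ioi hh) fun l _ => ?_
  rw [key, key]
  refine measure_initial_segment_le H inter_subset_right fun x hx y hy hyx => ⟨?_, hy⟩
  exact lt_of_lt_of_le hx.1 (hh hy hx.2 hyx)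

/-- Duality between an integral operator with a non-negative kernel and its transpose. -/
theorem lintegral_kernel_swap {α : Type*} [MeasurableSpace α] {μ : Measure α} [SFinite μ]
    {k : α → α → ℝ≥0∞} (hk : Measurable (Function.uncurry k)) {f w : α → ℝ≥0∞}
    (hf : AEMeasurable f μ) (hw : AEMeasurable w μ) :
    ∫⁻ z, (∫⁻ x, k z x * f x ∂μ) * w z ∂μ = ∫⁻ x, f x * ∫⁻ z, k z x * w z ∂μ ∂μ := by
  have hk1 : ∀ z, Measurable (k z) := fun z => hk.comp measurable_prodMk_left
  have hk2 : ∀ x, Measurable fun z => k z x := fun x => hk.comp measurable_prodMk_right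
  calc ∫⁻ z, (∫⁻ x, k z x * f x ∂μ) * w z ∂μ
      = ∫⁻ z, ∫⁻ x, k z x * f x * w z ∂μ ∂μ := lintegral_congr fun z =>
        (lintegral_mul_const'' _ ((hk1 z).aemeasurable.mul hf)).symm
    _ = ∫⁻ x, ∫⁻ z, k z x * f x * w z ∂μ ∂μ :=
        lintegral_lintegral_swap ((hk.aemeasurable.mul hf.comp_snd).mul hw.comp_fst)
    _ = _ := lintegral_congr fun x => by
        refine Eq.trans ?_ (lintegral_const_mul'' (f x) ((hk2 x).aemeasurable.mul hw))
        exact lintegral_congr fun z => by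
          ring

/-- Minkowski's inequality for countable sums. -/
theorem lintegral_Lp_tsum_le {α : Type*} [MeasurableSpace α] {μ : Measure α} {p : ℝ}
    (hp : 1 ≤ p) {g : ℕ → α → ℝ≥0∞} (hg : ∀ k, AEMeasurable (g k) μ) :
    (∫⁻ x, (∑' k, g k x) ^ p ∂μ) ^ (1 / p) ≤ ∑' k, (∫⁻ x, g k x ^ p ∂μ) ^ (1 / p) := by
  have hp0 : 0 < p := by linarith
  have hfin : ∀ n : ℕ, (∫⁻ x, (∑ k ∈ Finset.range n, g k x) ^ p ∂μ) ^ (1 / p) ≤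
      ∑ k ∈ Finset.range n, (∫⁻ x, g k x ^ p ∂μ) ^ (1 / p) := by
    intro n
    induction n with
    | zero => simp [hp0]
    | succ n ih =>
      simp only [Finset.sum_range_succ]
      have hm : AEMeasurable (fun x => ∑ k ∈ Finset.range n, g k x) μ :=
        Finset.aemeasurable_fun_sum _ fun k _ => hg k
      exact (ENNReal.lintegral_Lp_add_le hm (hg n) hp).trans (by gcongr)
  have hmono : ∀ x, Monotone fun n => ∑ k ∈ Finset.range n, g k x := fun x a b hab =>
    Finset.sum_le_sum_of_subset (Finset.range_mono hab)
  have h1 : ∀ x, (∑' k, g k x) ^ p = ⨆ n, (∑ k ∈ Finset.range n, g k x) ^ p := fun x => by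
    rw [ENNReal.tsum_eq_iSup_nat]
    exact (ENNReal.orderIsoRpow p hp0).map_iSup _
  simp only [h1]
  rw [lintegral_iSup' (fun n => (Finset.aemeasurable_fun_sum _ fun k _ => hg k).pow_const p)
    (.of_forall fun x a b hab => ENNReal.rpow_le_rpow (hmono x hab) hp0.le)]
  have h2 := (ENNReal.orderIsoRpow (1 / p) (by positivity)).map_iSup
    fun n => ∫⁻ x, (∑ k ∈ Finset.range n, g k x) ^ p ∂μ
  simp only [ENNReal.orderIsoRpow_apply] at h2
  rw [h2]
  exact iSup_le fun n => (hfin n).trans (ENNReal.sum_le_tsum _)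

/-! ### The one-dimensional Hardy operator -/

/-- The Hardy operator `h ↦ s⁻¹ ∫_0^s h` on non-negative functions on the half-line. -/
def hardy (h : ℝ → ℝ≥0∞) (s : ℝ) : ℝ≥0∞ :=
  (ENNReal.ofReal s)⁻¹ * ∫⁻ σ in Ioc 0 s, h σ

theorem hardy_mono {g h : ℝ → ℝ≥0∞} {s : ℝ} (H : ∀ σ, 0 < σ → g σ ≤ h σ) :
    hardy g s ≤ hardy h s := by
  unfold hardy
  gcongr 1
  exact setLIntegral_mono' measurableSet_Ioc fun x hx => H x hx.1

/-- The two-dimensional Hardy operator is the composition of the one-dimensional ones. -/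
theorem hardy₂_eq_hardy_hardy (f : ℝ × ℝ → ℝ≥0∞) {s t : ℝ} (hs : 0 < s) (ht : 0 < t) :
    hardy₂ f (s, t) = hardy (fun σ => hardy (fun τ => f (σ, τ)) t) s := by
  have ht' : ENNReal.ofReal t ≠ 0 := by simpa using ht
  have hs' : ENNReal.ofReal s ≠ 0 := by simpa using hs
  simp only [hardy₂, hardy]
  rw [lintegral_const_mul' _ _ (ENNReal.inv_ne_top.2 ht'), ENNReal.ofReal_mul hs.le,
    ENNReal.mul_inv (.inl hs') (.inr ht'), mul_assoc]

theorem setLIntegral_scale {c : ℝ} (hc : 0 < c) (g : ℝ → ℝ≥0∞) (S : Set ℝ) :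
    ∫⁻ x in S, g x = ENNReal.ofReal c * ∫⁻ x in (c * ·) ⁻¹' S, g (c * x) := by
  have hemb : MeasurableEmbedding (c * · : ℝ → ℝ) := measurableEmbedding_mulLeft₀ hc.ne'
  conv_lhs => rw [← Real.smul_map_volume_mul_left hc.ne', abs_of_pos hc]
  rw [Measure.restrict_smul, lintegral_smul_measure, hemb.restrict_map, hemb.lintegral_map,
    smul_eq_mul]

theorem preimage_mul_Ioi_zero {c : ℝ} (hc : 0 < c) : (c * · : ℝ → ℝ) ⁻¹' Ioi 0 = Ioi 0 := by
  ext x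
  simp [hc]

theorem preimage_mul_Ioc {c : ℝ} (hc : 0 < c) (r : ℝ) :
    (c * · : ℝ → ℝ) ⁻¹' Ioc 0 (c * r) = Ioc 0 r := by
  ext x
  simp only [mem_preimage, mem_Ioc, mul_pos_iff_of_pos_left hc]
  exact and_congr_right fun _ => mul_le_mul_iff_right₀ hc

theorem hardy_eq_lintegral_unit {s : ℝ} (hs : 0 < s) (h : ℝ → ℝ≥0∞) :
    hardy h s = ∫⁻ θ in Ioc 0 1, h (s * θ) := by
  have hs' : ENNReal.ofReal s ≠ 0 := by simpa using hs
  have h1 := setLIntegral_scale hs h (Ioc 0 (s * 1))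
  rw [preimage_mul_Ioc hs, mul_one] at h1
  rw [hardy, h1, ← mul_assoc, ENNReal.inv_mul_cancel hs' ENNReal.ofReal_ne_top, one_mul]

theorem hardy_antitoneOn {h : ℝ → ℝ≥0∞} (hh : AntitoneOn h (Ioi 0)) :
    AntitoneOn (hardy h) (Ioi 0) := by
  intro s hs t ht hst
  rw [hardy_eq_lintegral_unit hs, hardy_eq_lintegral_unit ht]
  refine setLIntegral_mono' measurableSet_Ioc fun θ hθ => hh ?_ ?_ ?_
  · exact mul_pos hs hθ.1
  · exact mul_pos ht hθ.1
  · exact mul_le_mul_of_nonneg_right hst hθ.1.le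

theorem mk_mem_quadrant {s t : ℝ} (hs : 0 < s) (ht : 0 < t) : (s, t) ∈ quadrant := ⟨hs, ht⟩

theorem antitoneOn_hardy_snd {f : ℝ × ℝ → ℝ≥0∞} (hf : AntitoneOn f quadrant) :
    AntitoneOn (fun z : ℝ × ℝ => hardy (fun τ => f (z.1, τ)) z.2) quadrant := by
  intro z hz z' hz' hzz
  refine le_trans ?_ (hardy_antitoneOn (h := fun τ => f (z.1, τ)) ?_ hz.2 hz'.2 hzz.2)
  · exact hardy_mono fun τ hτ => hf (mk_mem_quadrant hz.1 hτ) (mk_mem_quadrant hz'.1 hτ)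
      (Prod.mk_le_mk.2 ⟨hzz.1, le_rfl⟩)
  · exact fun a ha b hb hab => hf (mk_mem_quadrant hz.1 ha) (mk_mem_quadrant hz.1 hb)
      (Prod.mk_le_mk.2 ⟨le_rfl, hab⟩)

theorem hardy_indicator_Ioc (a : ℝ) {s : ℝ} (hs : 0 < s) :
    hardy ((Ioc 0 a).indicator 1) s = ENNReal.ofReal (min 1 (a / s)) := by
  have h1 : ∫⁻ σ in Ioc 0 s, (Ioc 0 a).indicator (1 : ℝ → ℝ≥0∞) σ =
      ENNReal.ofReal (min s a) := by
    rw [lintegral_indicator_one measurableSet_Ioc, Measure.restrict_apply measurableSet_Ioc,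
      Ioc_inter_Ioc, sup_idem, Real.volume_Ioc, sub_zero, min_comm]
  rw [hardy, h1, ← ENNReal.ofReal_inv_of_pos hs, ← ENNReal.ofReal_mul (by positivity)]
  congr 1
  rw [mul_min_of_nonneg _ _ (by positivity), inv_mul_cancel₀ hs.ne', div_eq_inv_mul]

/-- Comparison of two weights on decreasing functions. -/
theorem lintegral_antitone_mul_le {a b : ℝ → ℝ≥0∞} {C : ℝ≥0∞}
    (ha : AEMeasurable a (volume.restrict (Ioi 0)))
    (hb : AEMeasurable b (volume.restrict (Ioi 0)))
    (H : ∀ r : ℝ, 0 < r → ∫⁻ x in Ioc 0 r, a x ≤ C * ∫⁻ x in Ioc 0 r, b x)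
    {h : ℝ → ℝ≥0∞} (hh : AntitoneOn h (Ioi 0)) :
    ∫⁻ x in Ioi 0, h x * a x ≤ C * ∫⁻ x in Ioi 0, h x * b x := by
  have hm : AEMeasurable h (volume.restrict (Ioi 0)) :=
    aemeasurable_restrict_of_antitoneOn measurableSet_Ioi hh
  have key : ∀ c : ℝ → ℝ≥0∞, AEMeasurable c (volume.restrict (Ioi 0)) →
      ∫⁻ x in Ioi 0, h x ∂((volume.restrict (Ioi 0)).withDensity c) =
        ∫⁻ x in Ioi 0, h x * c x := fun c hc => by
    rw [restrict_withDensity measurableSet_Ioi, Measure.restrict_restrict measurableSet_Ioi,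
      inter_self, lintegral_withDensity_eq_lintegral_mul₀ hc hm]
    exact lintegral_congr fun x => mul_comm _ _
  have key2 : ∀ (c : ℝ → ℝ≥0∞) (r : ℝ),
      (volume.restrict (Ioi 0)).withDensity c (Ioc 0 r) = ∫⁻ x in Ioc 0 r, c x := fun c r => by
    rw [withDensity_apply _ measurableSet_Ioc, Measure.restrict_restrict measurableSet_Ioc,
      inter_eq_left.2 Ioc_subset_Ioi_self]
  have := lintegral_le_of_measure_Ioc_le (μ := (volume.restrict (Ioi 0)).withDensity a)
    (ν := (volume.restrict (Ioi 0)).withDensity b) (C := C)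
    (fun r hr => by rw [key2, key2]; exact H r hr) hh
  rwa [key a ha, key b hb] at this

/-- The Hardy operator integrated against a weight is dominated by its values on
the characteristic functions of the intervals `(0,r]`. -/
theorem lintegral_hardy_mul_le {u : ℝ → ℝ≥0∞} (hu : AEMeasurable u (volume.restrict (Ioi 0)))
    {C : ℝ≥0∞} (H : ∀ r : ℝ, 0 < r →
      ∫⁻ s in Ioi 0, hardy ((Ioc 0 r).indicator 1) s * u s ≤ C * ∫⁻ s in Ioc 0 r, u s)
    {h : ℝ → ℝ≥0∞} (hh : AntitoneOn h (Ioi 0)) :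
    ∫⁻ s in Ioi 0, hardy h s * u s ≤ C * ∫⁻ s in Ioi 0, h s * u s := by
  set μ : Measure ℝ := volume.restrict (Ioi 0)
  set k : ℝ → ℝ → ℝ≥0∞ := fun s σ =>
    {q : ℝ × ℝ | q.2 ≤ q.1}.indicator (fun q => (ENNReal.ofReal q.1)⁻¹) (s, σ) with hk_def
  have hk : Measurable (Function.uncurry k) :=
    (ENNReal.measurable_ofReal.comp measurable_fst).inv.indicator
      (measurableSet_le measurable_snd measurable_fst)
  have hhardy : ∀ (g : ℝ → ℝ≥0∞) (s : ℝ), 0 < s → hardy g s = ∫⁻ σ, k s σ * g σ ∂μ := by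
    intro g s hs
    have hs' : ENNReal.ofReal s ≠ 0 := by simpa using hs
    have e : Ioc 0 s = Iic s ∩ Ioi 0 := by ext; simp [and_comm]
    rw [hardy, e, ← Measure.restrict_restrict measurableSet_Iic,
      ← lintegral_indicator measurableSet_Iic,
      ← lintegral_const_mul' _ _ (ENNReal.inv_ne_top.2 hs')]
    refine lintegral_congr fun σ => ?_
    by_cases hσ : σ ≤ s <;> simp [hk_def, hσ]
  have adj : ∀ g : ℝ → ℝ≥0∞, AEMeasurable g μ →
      ∫⁻ s, hardy g s * u s ∂μ = ∫⁻ σ, g σ * ∫⁻ s, k s σ * u s ∂μ ∂μ := by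
    intro g hg
    rw [← lintegral_kernel_swap hk hg hu]
    refine setLIntegral_congr_fun measurableSet_Ioi fun s hs => ?_
    simp only [hhardy g s hs]
  have ha : AEMeasurable (fun σ => ∫⁻ s, k s σ * u s ∂μ) μ :=
    AEMeasurable.lintegral_prod_left'
      (f := fun q : ℝ × ℝ => k q.1 q.2 * u q.1) (hk.aemeasurable.mul hu.comp_fst)
  rw [adj h (aemeasurable_restrict_of_antitoneOn measurableSet_Ioi hh)]
  refine lintegral_antitone_mul_le ha hu (fun r hr => ?_) hh
  refine le_trans (le_of_eq ?_) (H r hr)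
  have h2 := adj ((Ioc 0 r).indicator 1) (aemeasurable_const.indicator measurableSet_Ioc)
  refine Eq.trans ?_ h2.symm
  have e : Ioc 0 r = Iic r ∩ Ioi 0 := by ext; simp [and_comm]
  conv_lhs => rw [e, ← Measure.restrict_restrict measurableSet_Iic,
    ← lintegral_indicator measurableSet_Iic]
  refine setLIntegral_congr_fun measurableSet_Ioi fun σ hσ => ?_
  have hσ' : 0 < σ := hσ
  by_cases hσr : σ ≤ r <;> simp [hσr, hσ']

/-- The integral of the `p`-th power of the Hardy transform of `χ_(0,r]` splits into the
mass of `(0,r]` and the tail appearing in the `B_p` condition. -/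
theorem lintegral_hardy_indicator_rpow (p : ℝ) {u : ℝ → ℝ≥0} {r : ℝ} (hr : 0 < r) :
    ∫⁻ s in Ioi 0, hardy ((Ioc 0 r).indicator 1) s ^ p * (u s : ℝ≥0∞) =
      (∫⁻ s in Ioc 0 r, (u s : ℝ≥0∞)) +
        ENNReal.ofReal (r ^ p) * ∫⁻ s in Ioi r, ENNReal.ofReal ((u s : ℝ) / s ^ p) := by
  rw [← Ioc_union_Ioi_eq_Ioi hr.le, lintegral_union measurableSet_Ioi (by
    rw [Set.disjoint_left]; exact fun x hx hx' => not_lt.2 hx.2 hx'),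
    ← lintegral_const_mul' _ _ ENNReal.ofReal_ne_top]
  congr 1
  · refine setLIntegral_congr_fun measurableSet_Ioc fun s hs => ?_
    rw [hardy_indicator_Ioc r hs.1, min_eq_left ((one_le_div hs.1).2 hs.2)]
    simp
  · refine setLIntegral_congr_fun measurableSet_Ioi fun s hs => ?_
    have hs0 : 0 < s := hr.trans hs
    rw [hardy_indicator_Ioc r hs0, min_eq_right ((div_le_one hs0).2 (le_of_lt hs)),
      ENNReal.ofReal_rpow_of_pos (by positivity), ← ENNReal.ofReal_coe_nnreal,
      ← ENNReal.ofReal_mul (by positivity), ← ENNReal.ofReal_mul (by positivity),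
      Real.div_rpow hr.le hs0.le]
    congr 1
    ring

/-! ### The Ariño–Muckenhoupt theorem -/

/-- The `B_p` condition forces the mass of `(0, 2^k r]` to grow strictly slower than `2^(kp)`. The
quantity `G r = ∫ (S χ_(0,r])^p u` is comparable to the mass of `(0,r]` and satisfies
`G (2 r) ≤ 2^p θ G r` with `θ < 1`. -/
theorem MemB.exists_growth {p : ℝ} (hp : 1 ≤ p) {u : ℝ → ℝ≥0}
    (hu : AEMeasurable (fun x => (u x : ℝ≥0∞)) (volume.restrict (Ioi 0)))
    (hfin : ∀ r : ℝ, ∫⁻ x in Ioc 0 r, (u x : ℝ≥0∞) ≠ ∞) (hB : MemB p u) :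
    ∃ K θ : ℝ≥0∞, K ≠ ∞ ∧ θ < 1 ∧ ∀ (k : ℕ) (r : ℝ), 0 < r →
      ∫⁻ x in Ioc 0 (2 ^ k * r), (u x : ℝ≥0∞) ≤
        K * (2 ^ p * θ) ^ k * ∫⁻ x in Ioc 0 r, (u x : ℝ≥0∞) := by
  obtain ⟨C, hC⟩ := hB
  have hp0 : 0 < p := by linarith
  set U : ℝ → ℝ≥0∞ := fun r => ∫⁻ x in Ioc 0 r, (u x : ℝ≥0∞) with hU
  set G : ℝ → ℝ≥0∞ := fun r =>
    ∫⁻ s in Ioi 0, hardy ((Ioc 0 r).indicator 1) s ^ p * (u s : ℝ≥0∞) with hG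
  set K : ℝ≥0∞ := 1 + C with hK
  have hKtop : K ≠ ∞ := by simp [hK]
  have hK0 : K ≠ 0 := by simp [hK]
  have hGU : ∀ r, 0 < r → G r ≤ K * U r := fun r hr => by
    simp only [hG, lintegral_hardy_indicator_rpow p hr, hK, add_mul, one_mul]
    exact add_le_add_right (hC r hr) _
  have hUG : ∀ r, 0 < r → U r ≤ G r := fun r hr => by
    simp only [hG, lintegral_hardy_indicator_rpow p hr]
    exact le_self_add
  have hGtop : ∀ r, 0 < r → G r ≠ ∞ := fun r hr =>
    ne_top_of_le_ne_top (ENNReal.mul_ne_top hKtop (hfin r)) (hGU r hr)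
  -- Halving `S χ_(0,2r]` leaves a function below `S χ_(0,r]`; on `(0,r]` it is at most `1/2`, and
  -- this gap is where the factor `θ < 1` comes from.
  have hpt : ∀ r x : ℝ, 0 < r → 0 < x →
      2⁻¹ ^ p * ENNReal.ofReal (min 1 (2 * r / x)) ^ p + 2⁻¹ * (Iic r).indicator 1 x ≤
        ENNReal.ofReal (min 1 (r / x)) ^ p := by
    intro r x hr hx
    rw [← ENNReal.mul_rpow_of_nonneg _ _ hp0.le]
    by_cases hxr : x ≤ r
    · rw [min_eq_left ((one_le_div hx).2 hxr), min_eq_left ((one_le_div hx).2 (by linarith)),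
        indicator_of_mem (by exact hxr)]
      simp only [ENNReal.ofReal_one, mul_one, Pi.one_apply, ENNReal.one_rpow]
      calc (2⁻¹ : ℝ≥0∞) ^ p + 2⁻¹ ≤ 2⁻¹ + 2⁻¹ := by
            gcongr
            exact ENNReal.rpow_le_self_of_le_one (by simp) hp
        _ = 1 := ENNReal.inv_two_add_inv_two
    · rw [indicator_of_notMem (by exact hxr), mul_zero, add_zero]
      refine ENNReal.rpow_le_rpow ?_ hp0.le
      rw [min_eq_right ((div_le_one hx).2 (not_le.1 hxr).le)]
      calc 2⁻¹ * ENNReal.ofReal (min 1 (2 * r / x)) ≤ 2⁻¹ * ENNReal.ofReal (2 * r / x) := by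
            gcongr; exact min_le_right _ _
        _ = ENNReal.ofReal (r / x) := by
            rw [mul_div_assoc, ENNReal.ofReal_mul (by norm_num), ← mul_assoc,
              ENNReal.ofReal_ofNat, ENNReal.inv_mul_cancel (by simp) (by simp), one_mul]
  have hstep : ∀ r, 0 < r → 2⁻¹ ^ p * G (2 * r) + 2⁻¹ * U r ≤ G r := by
    intro r hr
    have e : Ioc 0 r = Iic r ∩ Ioi 0 := by ext; simp [and_comm]
    simp only [hG, hU]
    rw [e, ← Measure.restrict_restrict measurableSet_Iic, ← lintegral_indicator measurableSet_Iic,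
      ← lintegral_const_mul' _ _ (ENNReal.rpow_ne_top_of_nonneg hp0.le (by simp)),
      ← lintegral_const_mul' _ _ (by simp),
      ← lintegral_add_right' _ ((hu.indicator measurableSet_Iic).const_mul _), ← e]
    refine setLIntegral_mono' measurableSet_Ioi fun x hx => ?_
    rw [hardy_indicator_Ioc (2 * r) hx, hardy_indicator_Ioc r hx]
    calc _ = (2⁻¹ ^ p * ENNReal.ofReal (min 1 (2 * r / x)) ^ p + 2⁻¹ * (Iic r).indicator 1 x) *
            (u x : ℝ≥0∞) := by
          by_cases hxr : x ≤ r
          · simp [hxr]; ring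
          · simp [hxr]; ring
      _ ≤ _ := by gcongr; exact hpt r x hr hx
  set θ : ℝ≥0∞ := 1 - (2 * K)⁻¹ with hθ
  have h2K : (2 * K) ≠ ∞ := ENNReal.mul_ne_top (by simp) hKtop
  have hθ1 : θ < 1 := ENNReal.sub_lt_self (by simp) (by simp) (ENNReal.inv_ne_zero.2 h2K)
  have hdbl : ∀ r, 0 < r → G (2 * r) ≤ 2 ^ p * θ * G r := by
    intro r hr
    have h1 : (2 * K)⁻¹ * G r ≤ 2⁻¹ * U r := by
      rw [ENNReal.mul_inv (by simp) (by simp), mul_assoc]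
      gcongr
      calc K⁻¹ * G r ≤ K⁻¹ * (K * U r) := by gcongr; exact hGU r hr
        _ = U r := by rw [← mul_assoc, ENNReal.inv_mul_cancel hK0 hKtop, one_mul]
    have h2 : 2⁻¹ ^ p * G (2 * r) ≤ θ * G r := by
      rw [hθ, ENNReal.sub_mul (fun _ _ => hGtop r hr), one_mul]
      refine ENNReal.le_sub_of_add_le_right ?_ ((add_le_add_right h1 _).trans (hstep r hr))
      exact ne_top_of_le_ne_top (ENNReal.mul_ne_top (by simp) (hfin r)) h1
    calc G (2 * r) = 2 ^ p * (2⁻¹ ^ p * G (2 * r)) := by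
          rw [← mul_assoc, ← ENNReal.mul_rpow_of_nonneg _ _ hp0.le,
            ENNReal.mul_inv_cancel (by simp) (by simp), ENNReal.one_rpow, one_mul]
      _ ≤ _ := by rw [mul_assoc]; gcongr
  have hiter : ∀ (k : ℕ) (r : ℝ), 0 < r → G (2 ^ k * r) ≤ (2 ^ p * θ) ^ k * G r := by
    intro k
    induction k with
    | zero => simp
    | succ k ih =>
      intro r hr
      calc G (2 ^ (k + 1) * r) = G (2 * (2 ^ k * r)) := by ring_nf
        _ ≤ 2 ^ p * θ * G (2 ^ k * r) := hdbl _ (by positivity)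
        _ ≤ 2 ^ p * θ * ((2 ^ p * θ) ^ k * G r) := by gcongr; exact ih r hr
        _ = _ := by ring
  refine ⟨K, θ, hKtop, hθ1, fun k r hr => ?_⟩
  calc U (2 ^ k * r) ≤ G (2 ^ k * r) := hUG _ (by positivity)
    _ ≤ (2 ^ p * θ) ^ k * G r := hiter k r hr
    _ ≤ (2 ^ p * θ) ^ k * (K * U r) := by gcongr; exact hGU r hr
    _ = _ := by ring

theorem quasiMeasurePreserving_mul_Ioi {c : ℝ} (hc : 0 < c) :
    Measure.QuasiMeasurePreserving (c * · : ℝ → ℝ) (volume.restrict (Ioi 0))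
      (volume.restrict (Ioi 0)) := by
  refine ⟨measurable_const_mul c, ?_⟩
  have hemb : MeasurableEmbedding (c * · : ℝ → ℝ) := measurableEmbedding_mulLeft₀ hc.ne'
  have h1 := hemb.restrict_map volume (Ioi 0)
  rw [preimage_mul_Ioi_zero hc, Real.map_volume_mul_left hc.ne', Measure.restrict_smul] at h1
  rw [← h1]
  exact Measure.smul_absolutelyContinuous

/-- If the masses of `(0, c r]` and `(0, r]` are comparable, the dilation by `c` is bounded
on decreasing functions. -/
theorem lintegral_dilation_le {u : ℝ → ℝ≥0∞} (hu : AEMeasurable u (volume.restrict (Ioi 0)))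
    {c : ℝ} (hc : 0 < c) {M : ℝ≥0∞}
    (H : ∀ r : ℝ, 0 < r → ∫⁻ x in Ioc 0 (c * r), u x ≤ M * ∫⁻ x in Ioc 0 r, u x)
    {h : ℝ → ℝ≥0∞} (hh : AntitoneOn h (Ioi 0)) :
    ∫⁻ x in Ioi 0, h (c⁻¹ * x) * u x ≤ M * ∫⁻ x in Ioi 0, h x * u x := by
  have h1 := setLIntegral_scale hc (fun x => h (c⁻¹ * x) * u x) (Ioi 0)
  rw [preimage_mul_Ioi_zero hc, ← lintegral_const_mul' _ _ ENNReal.ofReal_ne_top] at h1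
  rw [h1]
  have h2 : ∀ x : ℝ, ENNReal.ofReal c * (h (c⁻¹ * (c * x)) * u (c * x)) =
      h x * (ENNReal.ofReal c * u (c * x)) := fun x => by
    rw [inv_mul_cancel_left₀ hc.ne']; ring
  simp only [h2]
  refine lintegral_antitone_mul_le
    ((hu.comp_quasiMeasurePreserving (quasiMeasurePreserving_mul_Ioi hc)).const_mul _) hu
    (fun r hr => ?_) hh
  refine le_trans (le_of_eq ?_) (H r hr)
  rw [setLIntegral_scale hc u, preimage_mul_Ioc hc,
    lintegral_const_mul' _ _ ENNReal.ofReal_ne_top]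
  rfl

/-- For decreasing `h`, the average of `h` over `(0,s)` is dominated by a dyadic sum. -/
theorem hardy_le_tsum {h : ℝ → ℝ≥0∞} (hh : AntitoneOn h (Ioi 0)) {s : ℝ} (hs : 0 < s) :
    hardy h s ≤ ∑' k : ℕ, 2⁻¹ ^ (k + 1) * h ((2 ^ (k + 1))⁻¹ * s) := by
  have hsub : Ioc (0 : ℝ) 1 ⊆ ⋃ k : ℕ, Ioc ((2 ^ (k + 1))⁻¹) ((2 ^ k)⁻¹) := by
    intro θ hθ
    obtain ⟨n, hn1, hn2⟩ := exists_nat_pow_near_of_lt_one hθ.1 hθ.2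
      (y := (1 / 2 : ℝ)) (by norm_num) (by norm_num)
    refine mem_iUnion.2 ⟨n, ?_, ?_⟩
    · simpa using hn1
    · simpa using hn2
  rw [hardy_eq_lintegral_unit hs]
  refine (lintegral_mono_set hsub).trans ((lintegral_iUnion_le _ _).trans ?_)
  refine ENNReal.tsum_le_tsum fun k => ?_
  have h2k : (0 : ℝ) < (2 ^ (k + 1))⁻¹ := by positivity
  calc ∫⁻ θ in Ioc ((2 ^ (k + 1))⁻¹) ((2 ^ k)⁻¹), h (s * θ)
      ≤ ∫⁻ _ in Ioc ((2 ^ (k + 1))⁻¹ : ℝ) ((2 ^ k)⁻¹), h ((2 ^ (k + 1))⁻¹ * s) := by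
        refine setLIntegral_mono' measurableSet_Ioc fun θ hθ => hh ?_ ?_ ?_
        · exact mul_pos h2k hs
        · exact mul_pos hs (h2k.trans hθ.1)
        · rw [mul_comm]
          exact mul_le_mul_of_nonneg_left hθ.1.le hs.le
    _ = _ := by
        rw [setLIntegral_const, Real.volume_Ioc, mul_comm]
        congr 1
        have : ((2 : ℝ) ^ k)⁻¹ - (2 ^ (k + 1))⁻¹ = 2⁻¹ ^ (k + 1) := by
          rw [inv_pow, pow_succ]; field_simp; norm_num
        rw [this, ENNReal.ofReal_pow (by norm_num), ENNReal.ofReal_inv_of_pos (by norm_num),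
          ENNReal.ofReal_ofNat]

/-- Moving a weight into the function turns weighted `L^p` norms into unweighted ones, to which
Minkowski's inequality applies. -/
theorem mul_rpow_one_div_rpow {p : ℝ} (hp : 0 < p) (a b : ℝ≥0∞) :
    (a * b ^ (1 / p)) ^ p = a ^ p * b := by
  rw [ENNReal.mul_rpow_of_nonneg _ _ hp.le, ← ENNReal.rpow_mul, one_div_mul_cancel hp.ne',
    ENNReal.rpow_one]

/-- The Ariño–Muckenhoupt theorem: a `B_p` weight makes the Hardy operator bounded on the
decreasing functions of `L^p`. -/
theorem MemB.exists_hardy_bound {p : ℝ} (hp : 1 ≤ p) {u : ℝ → ℝ≥0}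
    (hu : AEMeasurable (fun x => (u x : ℝ≥0∞)) (volume.restrict (Ioi 0)))
    (hfin : ∀ r : ℝ, ∫⁻ x in Ioc 0 r, (u x : ℝ≥0∞) ≠ ∞) (hB : MemB p u) :
    ∃ A : ℝ≥0∞, A ≠ ∞ ∧ ∀ h : ℝ → ℝ≥0∞, AntitoneOn h (Ioi 0) →
      ∫⁻ x in Ioi 0, hardy h x ^ p * (u x : ℝ≥0∞) ≤
        A * ∫⁻ x in Ioi 0, h x ^ p * (u x : ℝ≥0∞) := by
  obtain ⟨K, θ, hK, hθ, hgrow⟩ := hB.exists_growth hp hu hfin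
  have hp0 : 0 < p := by linarith
  set S : ℝ≥0∞ := ∑' k : ℕ, K ^ (1 / p) * (θ ^ (1 / p)) ^ (k + 1) with hS
  have hStop : S ≠ ∞ := by
    have h1 : θ ^ (1 / p) < 1 := ENNReal.rpow_lt_one hθ (by positivity)
    rw [hS, ENNReal.tsum_mul_left]
    refine ENNReal.mul_ne_top (ENNReal.rpow_ne_top_of_nonneg (by positivity) hK) ?_
    simp only [pow_succ]
    rw [ENNReal.tsum_mul_right, ENNReal.tsum_geometric]
    exact ENNReal.mul_ne_top (ENNReal.inv_ne_top.2 (tsub_pos_of_lt h1).ne') h1.ne_top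
  refine ⟨S ^ p, ENNReal.rpow_ne_top_of_nonneg hp0.le hStop, fun h hh => ?_⟩
  have hhp : AntitoneOn (fun x => h x ^ p) (Ioi 0) := fun x hx y hy hxy =>
    ENNReal.rpow_le_rpow (hh hx hy hxy) hp0.le
  have hdil : ∀ k : ℕ, AntitoneOn (fun x => h ((2 ^ k)⁻¹ * x)) (Ioi 0) := fun k x hx y hy hxy =>
    have h2 : (0 : ℝ) < (2 ^ k)⁻¹ := by positivity
    hh (mul_pos h2 hx) (mul_pos h2 hy) (mul_le_mul_of_nonneg_left hxy h2.le)
  set μ : Measure ℝ := volume.restrict (Ioi 0)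
  set I : ℝ≥0∞ := ∫⁻ x, h x ^ p * (u x : ℝ≥0∞) ∂μ with hI
  have hum : AEMeasurable (fun x => (u x : ℝ≥0∞) ^ (1 / p)) μ := hu.pow_const _
  have hmul : ∀ (a : ℝ≥0∞) (x : ℝ), (a * (u x : ℝ≥0∞) ^ (1 / p)) ^ p = a ^ p * u x :=
    fun a x => mul_rpow_one_div_rpow hp0 a _
  -- The factor `2^{-k-1}` cancels the main part `2^p` of the growth bound for the dilation by
  -- `2^{k+1}`, which leaves a geometric series in `θ^{1/p}`.
  have hterm : ∀ k : ℕ, (∫⁻ x, (2⁻¹ ^ (k + 1) * h ((2 ^ (k + 1))⁻¹ * x) *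
      (u x : ℝ≥0∞) ^ (1 / p)) ^ p ∂μ) ^ (1 / p) ≤
        K ^ (1 / p) * (θ ^ (1 / p)) ^ (k + 1) * I ^ (1 / p) := by
    intro k
    have h1 := lintegral_dilation_le hu (c := 2 ^ (k + 1)) (by positivity) (hgrow (k + 1)) hhp
    have h2 : ∫⁻ x, (2⁻¹ ^ (k + 1) * h ((2 ^ (k + 1))⁻¹ * x) * (u x : ℝ≥0∞) ^ (1 / p)) ^ p ∂μ ≤
        ((2⁻¹ : ℝ≥0∞) ^ (k + 1)) ^ p * (K * (2 ^ p * θ) ^ (k + 1) * I) := by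
      refine le_trans (le_of_eq ?_) (mul_le_mul_right h1 _)
      rw [← lintegral_const_mul' _ _ (ENNReal.rpow_ne_top_of_nonneg hp0.le (by simp))]
      refine lintegral_congr fun x => ?_
      rw [hmul, ENNReal.mul_rpow_of_nonneg _ _ hp0.le, mul_assoc]
    have h3 : ((2⁻¹ : ℝ≥0∞) ^ (k + 1)) ^ p * (K * (2 ^ p * θ) ^ (k + 1) * I) =
        K * θ ^ (k + 1) * I := by
      have : ((2⁻¹ : ℝ≥0∞) ^ (k + 1)) ^ p = ((2 ^ p) ^ (k + 1))⁻¹ := by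
        rw [← ENNReal.inv_pow, ENNReal.inv_rpow, ← ENNReal.rpow_natCast, ← ENNReal.rpow_natCast,
          ← ENNReal.rpow_mul, ← ENNReal.rpow_mul, mul_comm p]
      rw [this, mul_pow]
      have h2p : ((2 : ℝ≥0∞) ^ p) ^ (k + 1) ≠ 0 := pow_ne_zero _ (by simp [ENNReal.rpow_eq_zero_iff])
      have h2p' : ((2 : ℝ≥0∞) ^ p) ^ (k + 1) ≠ ∞ :=
        ENNReal.pow_ne_top (ENNReal.rpow_ne_top_of_nonneg hp0.le (by simp))
      calc _ = (((2 : ℝ≥0∞) ^ p) ^ (k + 1))⁻¹ * ((2 : ℝ≥0∞) ^ p) ^ (k + 1) *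
            (K * θ ^ (k + 1) * I) := by ring
        _ = _ := by rw [ENNReal.inv_mul_cancel h2p h2p', one_mul]
    refine (ENNReal.rpow_le_rpow (h2.trans_eq h3) (by positivity)).trans_eq ?_
    rw [ENNReal.mul_rpow_of_nonneg _ _ (by positivity),
      ENNReal.mul_rpow_of_nonneg _ _ (by positivity), ← ENNReal.rpow_natCast,
      ← ENNReal.rpow_natCast, ← ENNReal.rpow_mul, ← ENNReal.rpow_mul, mul_comm (1 / p)]
  have hsum : (∫⁻ x, hardy h x ^ p * (u x : ℝ≥0∞) ∂μ) ^ (1 / p) ≤ S * I ^ (1 / p) := by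
    calc (∫⁻ x, hardy h x ^ p * (u x : ℝ≥0∞) ∂μ) ^ (1 / p)
        ≤ (∫⁻ x, (∑' k : ℕ, 2⁻¹ ^ (k + 1) * h ((2 ^ (k + 1))⁻¹ * x) *
            (u x : ℝ≥0∞) ^ (1 / p)) ^ p ∂μ) ^ (1 / p) := by
          gcongr ?_ ^ _
          refine setLIntegral_mono' measurableSet_Ioi fun x hx => ?_
          rw [ENNReal.tsum_mul_right, hmul]
          gcongr
          exact hardy_le_tsum hh hx
      _ ≤ ∑' k : ℕ, (∫⁻ x, (2⁻¹ ^ (k + 1) * h ((2 ^ (k + 1))⁻¹ * x) *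
            (u x : ℝ≥0∞) ^ (1 / p)) ^ p ∂μ) ^ (1 / p) :=
          lintegral_Lp_tsum_le hp fun k =>
            ((aemeasurable_restrict_of_antitoneOn measurableSet_Ioi (hdil (k + 1))).const_mul
              _).mul hum
      _ ≤ ∑' k : ℕ, K ^ (1 / p) * (θ ^ (1 / p)) ^ (k + 1) * I ^ (1 / p) :=
          ENNReal.tsum_le_tsum hterm
      _ = S * I ^ (1 / p) := ENNReal.tsum_mul_right
  have h4 := ENNReal.rpow_le_rpow hsum hp0.le
  rwa [ENNReal.mul_rpow_of_nonneg _ _ hp0.le, ← ENNReal.rpow_mul, ← ENNReal.rpow_mul,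
    one_div_mul_cancel hp0.ne', ENNReal.rpow_one, ENNReal.rpow_one] at h4

/-! ### Weights and decreasing sets -/

theorem enorm_coe_nnreal (a : ℝ≥0) : ‖(a : ℝ)‖ₑ = a := by
  rw [Real.enorm_eq_ofReal a.coe_nonneg, ENNReal.ofReal_coe_nnreal]

theorem IsWeight.aemeasurable {u : ℝ → ℝ≥0} (hu : IsWeight u) :
    AEMeasurable (fun x => (u x : ℝ≥0∞)) (volume.restrict (Ioi 0)) := by
  have h1 : AEMeasurable (fun x => (u x : ℝ)) (volume.restrict (Ioi 0)) :=
    hu.aestronglyMeasurable.aemeasurable.mono_measure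
      (Measure.restrict_mono Ioi_subset_Ici_self le_rfl)
  simpa [ENNReal.ofReal_coe_nnreal] using h1.ennreal_ofReal

theorem IsWeight.lintegral_ne_top {u : ℝ → ℝ≥0} (hu : IsWeight u) (r : ℝ) :
    ∫⁻ x in Ioc 0 r, (u x : ℝ≥0∞) ≠ ∞ := by
  have h1 : IntegrableOn (fun x => (u x : ℝ)) (Ioc 0 r) :=
    (hu.integrableOn_compact_subset Icc_subset_Ici_self isCompact_Icc).mono_set
      Ioc_subset_Icc_self
  have h2 := h1.2.ne
  simpa [enorm_coe_nnreal] using h2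

theorem IsWeight₂.aemeasurable {w : ℝ × ℝ → ℝ≥0} (hw : IsWeight₂ w) :
    AEMeasurable (fun z => (w z : ℝ≥0∞)) (volume.restrict quadrant) := by
  have h1 : AEMeasurable (fun z => (w z : ℝ)) (volume.restrict quadrant) :=
    hw.aestronglyMeasurable.aemeasurable.mono_measure
      (Measure.restrict_mono (prod_mono Ioi_subset_Ici_self Ioi_subset_Ici_self) le_rfl)
  simpa [ENNReal.ofReal_coe_nnreal] using h1.ennreal_ofReal

theorem lintegral_ne_zero_of_not_ae_zero {u : ℝ → ℝ≥0} (hu : IsWeight u)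
    (hu0 : ¬ (u =ᵐ[volume.restrict (Ioi 0)] 0)) :
    ∫⁻ x in Ioi 0, (u x : ℝ≥0∞) ≠ 0 := by
  intro h
  refine hu0 ?_
  filter_upwards [(lintegral_eq_zero_iff' hu.aemeasurable).1 h] with x hx
  simpa using hx

/-- A weight that is not a.e. zero has positive mass on some interval `(0,b]`. -/
theorem exists_lintegral_Ioc_ne_zero {u : ℝ → ℝ≥0} (hu : IsWeight u)
    (hu0 : ¬ (u =ᵐ[volume.restrict (Ioi 0)] 0)) :
    ∃ b : ℝ, 0 < b ∧ ∫⁻ x in Ioc 0 b, (u x : ℝ≥0∞) ≠ 0 := by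
  by_contra! hcon
  refine lintegral_ne_zero_of_not_ae_zero hu hu0 ?_
  have := lintegral_antitone_mul_le (C := 1) hu.aemeasurable (aemeasurable_const (b := 0))
    (fun r hr => by simp [hcon r hr]) (h := fun _ => 1) antitoneOn_const
  simpa using this

theorem isDecSet_iff {D : Set (ℝ × ℝ)} :
    IsDecSet D ↔ D ⊆ quadrant ∧ ∀ z ∈ quadrant, ∀ z' ∈ D, z ≤ z' → z ∈ D := by
  refine and_congr_right fun hD => ⟨fun h z hz z' hz' hzz => ?_, fun h z hz z' hz' hzz => ?_⟩
  · by_contra hzD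
    have := h hz (hD hz') hzz
    simp [hz', hzD] at this
  · by_cases hz'D : z' ∈ D
    · simp [hz'D, h z hz z' hz'D hzz]
    · simp [hz'D]

theorem IsDecSet.nullMeasurableSet {D : Set (ℝ × ℝ)} (hD : IsDecSet D) :
    NullMeasurableSet D volume := by
  rw [isDecSet_iff] at hD
  exact nullMeasurableSet_of_ordConnected ⟨fun x hx y hy z hz =>
    hD.2 z (ordConnected_quadrant.out (hD.1 hx) (hD.1 hy) hz) y hy hz.2⟩

theorem IsDecSet.antitoneOn {D : Set (ℝ × ℝ)} (hD : IsDecSet D) :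
    AntitoneOn (D.indicator (1 : ℝ × ℝ → ℝ≥0∞)) quadrant := by
  intro z hz z' hz' hzz
  by_cases hz'D : z' ∈ D
  · simp [hz'D, (isDecSet_iff.1 hD).2 z hz z' hz'D hzz]
  · simp [hz'D]

theorem isDecSet_Ioc_prod_Ioc (a b : ℝ) : IsDecSet (Ioc 0 a ×ˢ Ioc 0 b) :=
  isDecSet_iff.2 ⟨prod_mono Ioc_subset_Ioi_self Ioc_subset_Ioi_self,
    fun _ hz _ hz' hzz => ⟨⟨hz.1, hzz.1.trans hz'.1.2⟩, ⟨hz.2, hzz.2.trans hz'.2.2⟩⟩⟩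

theorem setLIntegral_quadrant_indicator {D : Set (ℝ × ℝ)} (hD : IsDecSet D) (p : ℝ) (hp : 0 < p)
    (w : ℝ × ℝ → ℝ≥0) :
    ∫⁻ z in quadrant, (D.indicator (1 : ℝ × ℝ → ℝ≥0∞) z) ^ p * (w z : ℝ≥0∞) =
      ∫⁻ z in D, (w z : ℝ≥0∞) := by
  have h1 : ∀ z, (D.indicator (1 : ℝ × ℝ → ℝ≥0∞) z) ^ p * (w z : ℝ≥0∞) =
      D.indicator (fun z => (w z : ℝ≥0∞)) z := fun z => by
    by_cases hz : z ∈ D <;> simp [hz, hp]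
  simp only [h1]
  have h2 : NullMeasurableSet D (volume.restrict quadrant) :=
    hD.nullMeasurableSet.mono_ac (Measure.absolutelyContinuous_of_le Measure.restrict_le_self)
  rw [lintegral_indicator₀ h2, Measure.restrict_restrict₀ h2, inter_eq_left.2 hD.1]

theorem coe_indicator_one (D : Set (ℝ × ℝ)) (z : ℝ × ℝ) :
    ((D.indicator (1 : ℝ × ℝ → ℝ≥0) z : ℝ≥0) : ℝ≥0∞) = D.indicator 1 z := by
  by_cases hz : z ∈ D <;> simp [hz]

theorem lpNorm_indicator {D : Set (ℝ × ℝ)} (hD : IsDecSet D) {p : ℝ} (hp : 0 < p)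
    (w : ℝ × ℝ → ℝ≥0) :
    lpNorm p w (D.indicator 1) = (∫⁻ z in D, (w z : ℝ≥0∞)) ^ (1 / p) := by
  rw [lpNorm, setLIntegral_quadrant_indicator hD p hp]

theorem rpow_le_rpow_of_lpNorm_le {p : ℝ} (hp : 0 < p) {w : ℝ × ℝ → ℝ≥0}
    {f g : ℝ × ℝ → ℝ≥0∞} {C : ℝ≥0∞} (h : lpNorm p w f ≤ C * lpNorm p w g) :
    ∫⁻ z in quadrant, f z ^ p * (w z : ℝ≥0∞) ≤
      C ^ p * ∫⁻ z in quadrant, g z ^ p * (w z : ℝ≥0∞) := by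
  have := ENNReal.rpow_le_rpow h hp.le
  rwa [lpNorm, lpNorm, ENNReal.mul_rpow_of_nonneg _ _ hp.le, ← ENNReal.rpow_mul,
    ← ENNReal.rpow_mul, one_div_mul_cancel hp.ne', ENNReal.rpow_one, ENNReal.rpow_one] at this

theorem lpNorm_le_of_lintegral_le {p : ℝ} (hp : 0 < p) {w : ℝ × ℝ → ℝ≥0}
    {f g : ℝ × ℝ → ℝ≥0∞} {C : ℝ≥0∞}
    (h : ∫⁻ z in quadrant, f z ^ p * (w z : ℝ≥0∞) ≤
      C * ∫⁻ z in quadrant, g z ^ p * (w z : ℝ≥0∞)) :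
    lpNorm p w f ≤ C ^ (1 / p) * lpNorm p w g := by
  have := ENNReal.rpow_le_rpow h (z := 1 / p) (by positivity)
  rwa [ENNReal.mul_rpow_of_nonneg _ _ (by positivity)] at this

theorem isDecLp_indicator {D : Set (ℝ × ℝ)} (hD : IsDecSet D) {p : ℝ} (hp : 0 < p)
    {w : ℝ × ℝ → ℝ≥0} (hfin : ∫⁻ z in D, (w z : ℝ≥0∞) ≠ ∞) :
    IsDecLp p w (D.indicator 1) := by
  refine ⟨hD.2, ?_⟩
  simp only [coe_indicator_one]
  rw [show (fun z => D.indicator (1 : ℝ × ℝ → ℝ≥0∞) z) = D.indicator 1 from rfl,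
    lpNorm_indicator hD hp]
  exact ENNReal.rpow_lt_top_of_nonneg (by positivity) hfin

/-- The `B_p^{(2)}` condition tested on characteristic functions of decreasing sets. -/
theorem MemB₂.lintegral_indicator_le {p : ℝ} (hp : 0 < p) {w : ℝ × ℝ → ℝ≥0} (h : MemB₂ p w) :
    ∃ C : ℝ≥0, ∀ D : Set (ℝ × ℝ), IsDecSet D → ∫⁻ z in D, (w z : ℝ≥0∞) ≠ ∞ →
      ∫⁻ z in quadrant, hardy₂ (D.indicator 1) z ^ p * (w z : ℝ≥0∞) ≤
        C * ∫⁻ z in D, (w z : ℝ≥0∞) := by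
  obtain ⟨C, hC⟩ := h
  refine ⟨C ^ p, fun D hD hfin => ?_⟩
  have h1 := hC _ (isDecLp_indicator hD hp hfin)
  simp only [coe_indicator_one] at h1
  have h2 := rpow_le_rpow_of_lpNorm_le hp h1
  rwa [setLIntegral_quadrant_indicator hD p hp, ← ENNReal.coe_rpow_of_nonneg _ hp.le] at h2

/-! ### Product weights -/

theorem coe_prodWeight (u v : ℝ → ℝ≥0) (z : ℝ × ℝ) :
    (prodWeight u v z : ℝ≥0∞) = (u z.1 : ℝ≥0∞) * (v z.2 : ℝ≥0∞) := by
  simp [prodWeight]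

theorem hardy₂_indicator_prod (a b : ℝ) {s t : ℝ} (hs : 0 < s) (ht : 0 < t) :
    hardy₂ ((Ioc 0 a ×ˢ Ioc 0 b).indicator 1) (s, t) =
      hardy ((Ioc 0 a).indicator 1) s * hardy ((Ioc 0 b).indicator 1) t := by
  have hind : ∀ σ τ : ℝ, (Ioc 0 a ×ˢ Ioc 0 b).indicator (1 : ℝ × ℝ → ℝ≥0∞) (σ, τ) =
      (Ioc 0 a).indicator 1 σ * (Ioc 0 b).indicator 1 τ := fun σ τ => by
    by_cases h1 : σ ∈ Ioc 0 a <;> by_cases h2 : τ ∈ Ioc 0 b <;> simp [h1, h2]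
  have hne : ∀ σ : ℝ, (Ioc 0 a).indicator (1 : ℝ → ℝ≥0∞) σ ≠ ∞ := fun σ => by
    by_cases h1 : σ ∈ Ioc 0 a <;> simp [h1]
  rw [hardy₂_eq_hardy_hardy _ hs ht]
  have h1 : ∀ σ, hardy (fun τ => (Ioc 0 a ×ˢ Ioc 0 b).indicator (1 : ℝ × ℝ → ℝ≥0∞) (σ, τ)) t =
      (Ioc 0 a).indicator 1 σ * hardy ((Ioc 0 b).indicator 1) t := fun σ => by
    simp only [hardy, hind]
    rw [lintegral_const_mul' _ _ (hne σ)]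
    ring
  have h2 : hardy ((Ioc 0 b).indicator 1) t ≠ ∞ := by
    rw [hardy_indicator_Ioc b ht]
    exact ENNReal.ofReal_ne_top
  simp only [h1]
  rw [hardy, lintegral_mul_const' _ _ h2, ← mul_assoc]
  rfl

theorem lintegral_prodWeight_rect {u v : ℝ → ℝ≥0} (hu : IsWeight u) (hv : IsWeight v) (a b : ℝ) :
    ∫⁻ z in Ioc 0 a ×ˢ Ioc 0 b, (prodWeight u v z : ℝ≥0∞) =
      (∫⁻ s in Ioc 0 a, (u s : ℝ≥0∞)) * ∫⁻ t in Ioc 0 b, (v t : ℝ≥0∞) := by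
  simp only [coe_prodWeight]
  rw [Measure.volume_eq_prod, ← Measure.prod_restrict]
  exact lintegral_prod_mul
    (hu.aemeasurable.mono_measure (Measure.restrict_mono Ioc_subset_Ioi_self le_rfl))
    (hv.aemeasurable.mono_measure (Measure.restrict_mono Ioc_subset_Ioi_self le_rfl))

theorem antitoneOn_indicator_Ioc (a : ℝ) :
    AntitoneOn ((Ioc 0 a).indicator (1 : ℝ → ℝ≥0∞)) (Ioi 0) := by
  intro x hx y _ hxy
  by_cases hya : y ∈ Ioc 0 a
  · have : x ∈ Ioc 0 a := ⟨hx, hxy.trans hya.2⟩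
    simp [hya, this]
  · simp [hya]

theorem aemeasurable_hardy_indicator (a : ℝ) :
    AEMeasurable (hardy ((Ioc 0 a).indicator 1)) (volume.restrict (Ioi 0)) :=
  aemeasurable_restrict_of_antitoneOn measurableSet_Ioi
    (hardy_antitoneOn (antitoneOn_indicator_Ioc a))

theorem lintegral_hardy₂_rect {p : ℝ} (hp : 0 ≤ p) {u v : ℝ → ℝ≥0} (hu : IsWeight u)
    (hv : IsWeight v) (a b : ℝ) :
    ∫⁻ z in quadrant, hardy₂ ((Ioc 0 a ×ˢ Ioc 0 b).indicator 1) z ^ p *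
        (prodWeight u v z : ℝ≥0∞) =
      (∫⁻ s in Ioi 0, hardy ((Ioc 0 a).indicator 1) s ^ p * (u s : ℝ≥0∞)) *
        ∫⁻ t in Ioi 0, hardy ((Ioc 0 b).indicator 1) t ^ p * (v t : ℝ≥0∞) := by
  rw [← lintegral_prod_mul
    (f := fun s => hardy ((Ioc 0 a).indicator 1) s ^ p * (u s : ℝ≥0∞))
    (g := fun t => hardy ((Ioc 0 b).indicator 1) t ^ p * (v t : ℝ≥0∞))
    (((aemeasurable_hardy_indicator a).pow_const p).mul hu.aemeasurable)
    (((aemeasurable_hardy_indicator b).pow_const p).mul hv.aemeasurable),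
    ← volume_restrict_quadrant]
  refine setLIntegral_congr_fun measurableSet_quadrant fun z hz => ?_
  rw [coe_prodWeight, hardy₂_indicator_prod a b hz.1 hz.2, ENNReal.mul_rpow_of_nonneg _ _ hp]
  ring

theorem lintegral_hardy_indicator_ne_zero {p : ℝ} {u : ℝ → ℝ≥0} (hu : IsWeight u)
    (hu0 : ¬ (u =ᵐ[volume.restrict (Ioi 0)] 0)) {a : ℝ} (ha : 0 < a) :
    ∫⁻ s in Ioi 0, hardy ((Ioc 0 a).indicator 1) s ^ p * (u s : ℝ≥0∞) ≠ 0 := by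
  intro h
  refine hu0 ?_
  filter_upwards [(lintegral_eq_zero_iff' (((aemeasurable_hardy_indicator a).pow_const p).mul
    hu.aemeasurable)).1 h, ae_restrict_mem measurableSet_Ioi] with s hs hs0
  have hs0' : 0 < s := hs0
  rcases mul_eq_zero.1 hs with h1 | h1
  · simp only [hardy_indicator_Ioc a hs0'] at h1
    exact absurd h1 (ENNReal.rpow_pos (by simp [hs0', ha]) ENNReal.ofReal_ne_top).ne'
  · simpa using h1

theorem antitoneOn_hardy₂ {f : ℝ × ℝ → ℝ≥0∞} (hf : AntitoneOn f quadrant) :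
    AntitoneOn (hardy₂ f) quadrant := by
  intro z hz z' hz' hzz
  rw [← Prod.mk.eta (p := z), ← Prod.mk.eta (p := z'), hardy₂_eq_hardy_hardy f hz.1 hz.2,
    hardy₂_eq_hardy_hardy f hz'.1 hz'.2]
  have hanti : AntitoneOn (fun σ => hardy (fun τ => f (σ, τ)) z.2) (Ioi 0) :=
    fun a ha b hb hab => antitoneOn_hardy_snd hf (mk_mem_quadrant ha hz.2)
      (mk_mem_quadrant hb hz.2) (Prod.mk_le_mk.2 ⟨hab, le_rfl⟩)
  refine le_trans (hardy_mono fun σ hσ => ?_) (hardy_antitoneOn hanti hz.1 hz'.1 hzz.1)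
  exact antitoneOn_hardy_snd hf (mk_mem_quadrant hσ hz.2) (mk_mem_quadrant hσ hz'.2)
    (Prod.mk_le_mk.2 ⟨le_rfl, hzz.2⟩)

/-- Bounds for the one-dimensional Hardy operator in each variable multiply to a bound for the
two-dimensional one: `S²` is applied one variable at a time, and after the first step the function
is still decreasing in the other variable. -/
theorem lintegral_hardy₂_prodWeight_le {p : ℝ} {u v : ℝ → ℝ≥0}
    (hu : AEMeasurable (fun x => (u x : ℝ≥0∞)) (volume.restrict (Ioi 0)))
    (hv : AEMeasurable (fun x => (v x : ℝ≥0∞)) (volume.restrict (Ioi 0)))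
    {A B : ℝ≥0∞} (hAtop : A ≠ ∞) (hBtop : B ≠ ∞)
    (hA : ∀ h : ℝ → ℝ≥0∞, AntitoneOn h (Ioi 0) →
      ∫⁻ x in Ioi 0, hardy h x ^ p * (u x : ℝ≥0∞) ≤ A * ∫⁻ x in Ioi 0, h x ^ p * (u x : ℝ≥0∞))
    (hB : ∀ h : ℝ → ℝ≥0∞, AntitoneOn h (Ioi 0) →
      ∫⁻ x in Ioi 0, hardy h x ^ p * (v x : ℝ≥0∞) ≤ B * ∫⁻ x in Ioi 0, h x ^ p * (v x : ℝ≥0∞))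
    {f : ℝ × ℝ → ℝ≥0∞} (hf : AntitoneOn f quadrant) :
    ∫⁻ z in quadrant, hardy₂ f z ^ p * (prodWeight u v z : ℝ≥0∞) ≤
      A * B * ∫⁻ z in quadrant, f z ^ p * (prodWeight u v z : ℝ≥0∞) := by
  set μ : Measure ℝ := volume.restrict (Ioi 0)
  set g : ℝ → ℝ → ℝ≥0∞ := fun σ t => hardy (fun τ => f (σ, τ)) t with hg
  have hgm : AEMeasurable (fun z : ℝ × ℝ => g z.1 z.2) (μ.prod μ) := by
    have := aemeasurable_of_antitoneOn_quadrant (antitoneOn_hardy_snd hf)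
    rwa [volume_restrict_quadrant] at this
  have hfm : AEMeasurable f (μ.prod μ) := by
    have := aemeasurable_of_antitoneOn_quadrant hf
    rwa [volume_restrict_quadrant] at this
  have hwm : AEMeasurable (fun z : ℝ × ℝ => (u z.1 : ℝ≥0∞) * (v z.2 : ℝ≥0∞)) (μ.prod μ) :=
    hu.comp_fst.mul hv.comp_snd
  have hstep1 : ∀ t, 0 < t → ∫⁻ s, hardy (fun σ => g σ t) s ^ p * (u s : ℝ≥0∞) ∂μ ≤
      A * ∫⁻ s, g s t ^ p * (u s : ℝ≥0∞) ∂μ := fun t ht =>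
    hA _ fun a ha b hb hab => hardy_mono fun τ hτ =>
      hf (mk_mem_quadrant ha hτ) (mk_mem_quadrant hb hτ) (Prod.mk_le_mk.2 ⟨hab, le_rfl⟩)
  have hstep2 : ∀ s, 0 < s → ∫⁻ t, g s t ^ p * (v t : ℝ≥0∞) ∂μ ≤
      B * ∫⁻ t, f (s, t) ^ p * (v t : ℝ≥0∞) ∂μ := fun s hs =>
    hB _ fun a ha b hb hab =>
      hf (mk_mem_quadrant hs ha) (mk_mem_quadrant hs hb) (Prod.mk_le_mk.2 ⟨le_rfl, hab⟩)
  have hH : AEMeasurable (hardy₂ f) (μ.prod μ) := by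
    have := aemeasurable_of_antitoneOn_quadrant (antitoneOn_hardy₂ hf)
    rwa [volume_restrict_quadrant] at this
  simp only [coe_prodWeight]
  rw [volume_restrict_quadrant,
    lintegral_prod_symm (fun z => hardy₂ f z ^ p * ((u z.1 : ℝ≥0∞) * (v z.2 : ℝ≥0∞)))
      ((hH.pow_const p).mul hwm),
    lintegral_prod (fun z => f z ^ p * ((u z.1 : ℝ≥0∞) * (v z.2 : ℝ≥0∞)))
      ((hfm.pow_const p).mul hwm)]
  calc ∫⁻ t, ∫⁻ s, hardy₂ f (s, t) ^ p * ((u s : ℝ≥0∞) * (v t : ℝ≥0∞)) ∂μ ∂μ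
      = ∫⁻ t, (v t : ℝ≥0∞) * ∫⁻ s, hardy (fun σ => g σ t) s ^ p * (u s : ℝ≥0∞) ∂μ ∂μ := by
        refine setLIntegral_congr_fun measurableSet_Ioi fun t ht => ?_
        rw [← lintegral_const_mul' _ _ ENNReal.coe_ne_top]
        refine setLIntegral_congr_fun measurableSet_Ioi fun s hs => ?_
        rw [hardy₂_eq_hardy_hardy f hs ht]
        ring
    _ ≤ ∫⁻ t, (v t : ℝ≥0∞) * (A * ∫⁻ s, g s t ^ p * (u s : ℝ≥0∞) ∂μ) ∂μ :=
        setLIntegral_mono' measurableSet_Ioi fun t ht => by gcongr; exact hstep1 t ht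
    _ = A * ∫⁻ t, ∫⁻ s, g s t ^ p * ((u s : ℝ≥0∞) * (v t : ℝ≥0∞)) ∂μ ∂μ := by
        rw [← lintegral_const_mul' _ _ hAtop]
        refine lintegral_congr fun t => ?_
        rw [mul_left_comm, ← lintegral_const_mul' _ _ ENNReal.coe_ne_top]
        congr 1
        exact lintegral_congr fun s => by ring
    _ = A * ∫⁻ s, ∫⁻ t, g s t ^ p * ((u s : ℝ≥0∞) * (v t : ℝ≥0∞)) ∂μ ∂μ := by
        rw [lintegral_lintegral_swap (f := fun s t => g s t ^ p *
          ((u s : ℝ≥0∞) * (v t : ℝ≥0∞))) ((hgm.pow_const p).mul hwm)]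
    _ = A * ∫⁻ s, (u s : ℝ≥0∞) * ∫⁻ t, g s t ^ p * (v t : ℝ≥0∞) ∂μ ∂μ := by
        congr 1
        refine lintegral_congr fun s => ?_
        rw [← lintegral_const_mul' _ _ ENNReal.coe_ne_top]
        exact lintegral_congr fun t => by ring
    _ ≤ A * ∫⁻ s, (u s : ℝ≥0∞) * (B * ∫⁻ t, f (s, t) ^ p * (v t : ℝ≥0∞) ∂μ) ∂μ := by
        gcongr A * ?_
        exact setLIntegral_mono' measurableSet_Ioi fun s hs => by gcongr; exact hstep2 s hs
    _ = A * B * ∫⁻ s, ∫⁻ t, f (s, t) ^ p * ((u s : ℝ≥0∞) * (v t : ℝ≥0∞)) ∂μ ∂μ := by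
        rw [mul_assoc]
        congr 1
        rw [← lintegral_const_mul' _ _ hBtop]
        refine lintegral_congr fun s => ?_
        rw [mul_left_comm, ← lintegral_const_mul' _ _ ENNReal.coe_ne_top]
        congr 1
        exact lintegral_congr fun t => by ring

theorem memB₂_prodWeight_of_memB {p : ℝ} (hp : 1 ≤ p) {u v : ℝ → ℝ≥0} (hu : IsWeight u)
    (hv : IsWeight v) (hBu : MemB p u) (hBv : MemB p v) : MemB₂ p (prodWeight u v) := by
  have hp0 : 0 < p := by linarith
  obtain ⟨A, hA, hA'⟩ := hBu.exists_hardy_bound hp hu.aemeasurable hu.lintegral_ne_top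
  obtain ⟨B, hB, hB'⟩ := hBv.exists_hardy_bound hp hv.aemeasurable hv.lintegral_ne_top
  have hAB : (A * B) ^ (1 / p) ≠ ∞ :=
    ENNReal.rpow_ne_top_of_nonneg (by positivity) (ENNReal.mul_ne_top hA hB)
  refine ⟨((A * B) ^ (1 / p)).toNNReal, fun f hf => ?_⟩
  rw [ENNReal.coe_toNNReal hAB]
  refine lpNorm_le_of_lintegral_le hp0 ?_
  exact lintegral_hardy₂_prodWeight_le hu.aemeasurable hv.aemeasurable hA hB hA' hB'
    fun z hz z' hz' hzz => by exact_mod_cast hf.1 hz hz' hzz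

/-- Testing on rectangles `(0,a] × (0,b]` with `b` fixed recovers the one-dimensional condition. -/
theorem memB_of_rect_le {p : ℝ} {u : ℝ → ℝ≥0} {C : ℝ≥0} {V V' : ℝ≥0∞} (hV : V ≠ 0)
    (hV' : V ≠ ∞) (hVV' : V ≤ V')
    (H : ∀ a : ℝ, 0 < a →
      (∫⁻ s in Ioi 0, hardy ((Ioc 0 a).indicator 1) s ^ p * (u s : ℝ≥0∞)) * V' ≤
        C * ((∫⁻ s in Ioc 0 a, (u s : ℝ≥0∞)) * V)) : MemB p u := by
  refine ⟨C, fun r hr => ?_⟩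
  have h1 := H r hr
  rw [lintegral_hardy_indicator_rpow p hr, ← mul_assoc] at h1
  refine (ENNReal.mul_le_mul_iff_left hV hV').1 (le_trans ?_ h1)
  gcongr
  exact le_add_self

theorem memB_of_memB₂_prodWeight {p : ℝ} (hp : 1 ≤ p) {u v : ℝ → ℝ≥0} (hu : IsWeight u)
    (hv : IsWeight v) (hu0 : ¬ (u =ᵐ[volume.restrict (Ioi 0)] 0))
    (hv0 : ¬ (v =ᵐ[volume.restrict (Ioi 0)] 0)) (h : MemB₂ p (prodWeight u v)) :
    MemB p u ∧ MemB p v := by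
  have hp0 : 0 < p := by linarith
  obtain ⟨C, hC⟩ := h.lintegral_indicator_le hp0
  have hrect : ∀ a b : ℝ,
      (∫⁻ s in Ioi 0, hardy ((Ioc 0 a).indicator 1) s ^ p * (u s : ℝ≥0∞)) *
        (∫⁻ t in Ioi 0, hardy ((Ioc 0 b).indicator 1) t ^ p * (v t : ℝ≥0∞)) ≤
      C * ((∫⁻ s in Ioc 0 a, (u s : ℝ≥0∞)) * ∫⁻ t in Ioc 0 b, (v t : ℝ≥0∞)) := fun a b => by
    have := hC _ (isDecSet_Ioc_prod_Ioc a b) (by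
      rw [lintegral_prodWeight_rect hu hv]
      exact ENNReal.mul_ne_top (hu.lintegral_ne_top a) (hv.lintegral_ne_top b))
    rwa [lintegral_hardy₂_rect hp0.le hu hv, lintegral_prodWeight_rect hu hv] at this
  obtain ⟨a, ha, ha'⟩ := exists_lintegral_Ioc_ne_zero hu hu0
  obtain ⟨b, hb, hb'⟩ := exists_lintegral_Ioc_ne_zero hv hv0
  constructor
  · refine memB_of_rect_le hb' (hv.lintegral_ne_top b) ?_ fun r _ => hrect r b
    rw [lintegral_hardy_indicator_rpow p hb]
    exact le_self_add
  · refine memB_of_rect_le (C := C)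
      (V' := ∫⁻ s in Ioi 0, hardy ((Ioc 0 a).indicator 1) s ^ p * (u s : ℝ≥0∞))
      ha' (hu.lintegral_ne_top a) ?_ fun r _ => ?_
    · rw [lintegral_hardy_indicator_rpow p ha]
      exact le_self_add
    · rw [mul_comm, mul_comm (∫⁻ t in Ioc 0 r, (v t : ℝ≥0∞))]
      exact hrect a r

/-! ### The supremum over decreasing sets for product weights -/

/-- The ratio whose supremum is `tailSup`. -/
def tailRatio (u : ℝ → ℝ≥0) (a : ℝ) : ℝ≥0∞ :=
  (ENNReal.ofReal a * ∫⁻ s in Ioi a, ENNReal.ofReal ((u s : ℝ) / s)) /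
    ∫⁻ s in Ioc 0 a, (u s : ℝ≥0∞)

theorem lintegral_hardy_indicator {u : ℝ → ℝ≥0} {r : ℝ} (hr : 0 < r) :
    ∫⁻ s in Ioi 0, hardy ((Ioc 0 r).indicator 1) s * (u s : ℝ≥0∞) =
      (∫⁻ s in Ioc 0 r, (u s : ℝ≥0∞)) +
        ENNReal.ofReal r * ∫⁻ s in Ioi r, ENNReal.ofReal ((u s : ℝ) / s) := by
  have := lintegral_hardy_indicator_rpow 1 (u := u) hr
  simpa only [ENNReal.rpow_one, Real.rpow_one] using this

theorem lintegral_hardy_le_tailSup {u : ℝ → ℝ≥0} (hu : IsWeight u) (hT : tailSup u ≠ ∞)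
    {h : ℝ → ℝ≥0∞} (hh : AntitoneOn h (Ioi 0)) :
    ∫⁻ s in Ioi 0, hardy h s * (u s : ℝ≥0∞) ≤
      (1 + tailSup u) * ∫⁻ s in Ioi 0, h s * (u s : ℝ≥0∞) := by
  refine lintegral_hardy_mul_le hu.aemeasurable (fun r hr => ?_) hh
  rw [lintegral_hardy_indicator hr, add_mul, one_mul]
  refine add_le_add_right ?_ _
  refine (ENNReal.div_le_iff_le_mul (.inr hT) (.inl (hu.lintegral_ne_top r))).1 ?_
  exact le_iSup₂_of_le r hr le_rfl

theorem decSup_prodWeight_le {u v : ℝ → ℝ≥0} (hu : IsWeight u) (hv : IsWeight v) :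
    decSup (prodWeight u v) ≤ (1 + tailSup u) * (1 + tailSup v) := by
  by_cases hTu : tailSup u = ∞
  · simp [hTu]
  by_cases hTv : tailSup v = ∞
  · simp [hTv]
  refine iSup₂_le fun D hD => ENNReal.div_le_of_le_mul ?_
  have h1 := lintegral_hardy₂_prodWeight_le (p := 1) hu.aemeasurable hv.aemeasurable
    (A := 1 + tailSup u) (B := 1 + tailSup v) (by simp [hTu]) (by simp [hTv])
    (fun h hh => by simpa only [ENNReal.rpow_one] using lintegral_hardy_le_tailSup hu hTu hh)
    (fun h hh => by simpa only [ENNReal.rpow_one] using lintegral_hardy_le_tailSup hv hTv hh)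
    hD.antitoneOn
  rw [setLIntegral_quadrant_indicator hD 1 one_pos] at h1
  simpa only [ENNReal.rpow_one] using h1

theorem le_decSup_prodWeight {u v : ℝ → ℝ≥0} (hu : IsWeight u) (hv : IsWeight v)
    (hu0 : ¬ (u =ᵐ[volume.restrict (Ioi 0)] 0)) (hv0 : ¬ (v =ᵐ[volume.restrict (Ioi 0)] 0))
    {a b : ℝ} (ha : 0 < a) (hb : 0 < b) :
    (1 + tailRatio u a) * (1 + tailRatio v b) ≤ decSup (prodWeight u v) := by
  refine le_iSup₂_of_le (Ioc 0 a ×ˢ Ioc 0 b) (isDecSet_Ioc_prod_Ioc a b) ?_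
  have h1 := lintegral_hardy₂_rect zero_le_one hu hv a b
  simp only [ENNReal.rpow_one] at h1
  rw [h1, lintegral_prodWeight_rect hu hv]
  have hGu : ∫⁻ s in Ioi 0, hardy ((Ioc 0 a).indicator 1) s * (u s : ℝ≥0∞) ≠ 0 := by
    simpa only [ENNReal.rpow_one] using lintegral_hardy_indicator_ne_zero (p := 1) hu hu0 ha
  have hGv : ∫⁻ s in Ioi 0, hardy ((Ioc 0 b).indicator 1) s * (v s : ℝ≥0∞) ≠ 0 := by
    simpa only [ENNReal.rpow_one] using lintegral_hardy_indicator_ne_zero (p := 1) hv hv0 hb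
  -- A vanishing denominator makes the quotient infinite, as the numerator is positive.
  by_cases h0 : (∫⁻ s in Ioc 0 a, (u s : ℝ≥0∞)) * ∫⁻ t in Ioc 0 b, (v t : ℝ≥0∞) = 0
  · rw [h0, ENNReal.div_zero (mul_ne_zero hGu hGv)]
    exact le_top
  obtain ⟨hU, hV⟩ := mul_ne_zero_iff.1 h0
  have key : ∀ {q : ℝ → ℝ≥0} (hq : IsWeight q) {c : ℝ} (hc : 0 < c)
      (hQ : ∫⁻ s in Ioc 0 c, (q s : ℝ≥0∞) ≠ 0),
      1 + tailRatio q c = (∫⁻ s in Ioi 0, hardy ((Ioc 0 c).indicator 1) s * (q s : ℝ≥0∞)) /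
        ∫⁻ s in Ioc 0 c, (q s : ℝ≥0∞) := fun hq c hc hQ => by
    rw [lintegral_hardy_indicator hc, ENNReal.add_div,
      ENNReal.div_self hQ (hq.lintegral_ne_top c)]
    rfl
  rw [key hu ha hU, key hv hb hV, ENNReal.div_eq_inv_mul, ENNReal.div_eq_inv_mul,
    ENNReal.div_eq_inv_mul, ENNReal.mul_inv (.inl hU) (.inr hV)]
  exact le_of_eq (by ring)

theorem decSup_prodWeight {u v : ℝ → ℝ≥0} (hu : IsWeight u) (hv : IsWeight v)
    (hu0 : ¬ (u =ᵐ[volume.restrict (Ioi 0)] 0)) (hv0 : ¬ (v =ᵐ[volume.restrict (Ioi 0)] 0)) :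
    decSup (prodWeight u v) = (1 + tailSup u) * (1 + tailSup v) := by
  refine le_antisymm (decSup_prodWeight_le hu hv) ?_
  have key : ∀ q : ℝ → ℝ≥0, 1 + tailSup q = ⨆ a : Ioi (0 : ℝ), (1 + tailRatio q a) := fun q => by
    have : Nonempty (Ioi (0 : ℝ)) := ⟨⟨1, mem_Ioi.2 one_pos⟩⟩
    rw [← ENNReal.add_iSup, tailSup, iSup_subtype']
    rfl
  rw [key, key, ENNReal.iSup_mul]
  refine iSup_le fun a => ?_
  rw [ENNReal.mul_iSup]
  exact iSup_le fun b => le_decSup_prodWeight hu hv hu0 hv0 a.2 b.2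

/-! ### The constant weight -/

theorem memBOneWeak_one : MemBOneWeak fun _ => 1 := by
  refine ⟨1, fun s r hs hsr => ?_⟩
  have h : ∀ t : ℝ, 0 < t →
      ENNReal.ofReal (1 / t) * ∫⁻ _ in Ioc 0 t, ((1 : ℝ≥0) : ℝ≥0∞) = 1 := fun t ht => by
    rw [ENNReal.coe_one, setLIntegral_one, Real.volume_Ioc, sub_zero,
      ← ENNReal.ofReal_mul (by positivity), one_div_mul_cancel ht.ne', ENNReal.ofReal_one]
  rw [h s hs, h r (hs.trans_le hsr), ENNReal.coe_one, one_mul]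

/-- For `l = 2⁻ⁿ`, the set where the Hardy transform of the unit square exceeds `l` contains `n`
disjoint dyadic rectangles of area `2ⁿ⁻¹`, so that the weak-type norm is infinite. -/
theorem not_memB₂Weak_one : ¬ MemB₂Weak 1 fun _ => 1 := by
  rintro ⟨C, hC⟩
  set D : Set (ℝ × ℝ) := Ioc 0 1 ×ˢ Ioc 0 1 with hD_def
  have hD : IsDecSet D := isDecSet_Ioc_prod_Ioc 1 1
  have hvol : ∫⁻ _ in D, ((1 : ℝ≥0) : ℝ≥0∞) = 1 := by
    rw [ENNReal.coe_one, setLIntegral_one, hD_def, Measure.volume_eq_prod, Measure.prod_prod]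
    simp
  have h1 := hC _ (isDecLp_indicator (w := fun _ => 1) hD one_pos (by rw [hvol]; simp))
  simp only [coe_indicator_one] at h1
  rw [show (fun z => D.indicator (1 : ℝ × ℝ → ℝ≥0∞) z) = D.indicator 1 from rfl,
    lpNorm_indicator (w := fun _ => 1) hD one_pos, hvol, ENNReal.one_rpow, mul_one] at h1
  have hn : ∀ n : ℕ, (n : ℝ≥0∞) * 2⁻¹ ≤ C := by
    intro n
    set R : ℕ → Set (ℝ × ℝ) := fun k => Ico (2 ^ k) (2 ^ (k + 1)) ×ˢ Ioo 0 (2 ^ n / 2 ^ (k + 1))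
      with hR
    have hRvol : ∀ k, volume (R k) = ENNReal.ofReal (2 ^ n * 2⁻¹) := fun k => by
      rw [hR, Measure.volume_eq_prod, Measure.prod_prod, Real.volume_Ico, Real.volume_Ioo,
        ← ENNReal.ofReal_mul (by rw [pow_succ]; nlinarith [pow_pos (two_pos (α := ℝ)) k])]
      congr 1
      rw [pow_succ]
      field_simp
      ring
    have hdisj : ((Finset.range n : Finset ℕ) : Set ℕ).PairwiseDisjoint R := by
      intro i _ j _ hij
      have key : ∀ {i j : ℕ}, i < j → Disjoint (R i) (R j) := fun {i j} hij => by
        rw [Set.disjoint_left]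
        rintro z ⟨hz, -⟩ ⟨hz', -⟩
        have : (2 : ℝ) ^ (i + 1) ≤ 2 ^ j := pow_le_pow_right₀ one_le_two hij
        exact absurd (hz.2.trans_le this) (not_lt.2 hz'.1)
      rcases lt_or_gt_of_ne hij with h | h
      · exact key h
      · exact (key h).symm
    have hsub : (⋃ k ∈ Finset.range n, R k) ⊆
        {z ∈ quadrant | (((2 ^ n)⁻¹ : ℝ≥0) : ℝ≥0∞) < hardy₂ (D.indicator 1) z} := by
      refine iUnion₂_subset fun k hk z hz => ?_
      have hk' : k + 1 ≤ n := Finset.mem_range.1 hk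
      have hs : (1 : ℝ) ≤ z.1 := le_trans (one_le_pow₀ one_le_two) hz.1.1
      have hs0 : 0 < z.1 := by linarith
      have ht0 : 0 < z.2 := hz.2.1
      refine ⟨⟨hs0, ht0⟩, ?_⟩
      have e1 : hardy₂ (D.indicator 1) z = ENNReal.ofReal (min 1 (1 / z.1) * min 1 (1 / z.2)) := by
        rw [← Prod.mk.eta (p := z), hD_def, hardy₂_indicator_prod 1 1 hs0 ht0,
          hardy_indicator_Ioc 1 hs0, hardy_indicator_Ioc 1 ht0, ENNReal.ofReal_mul (by positivity)]
      rw [e1, ← ENNReal.ofReal_coe_nnreal]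
      refine (ENNReal.ofReal_lt_ofReal_iff (by positivity)).2 ?_
      have h2k : (0 : ℝ) < 2 ^ (k + 1) := by positivity
      have hA : ((2 : ℝ) ^ (k + 1))⁻¹ < min 1 (1 / z.1) := by
        rw [min_eq_right ((div_le_one hs0).2 hs), one_div]
        exact inv_strictAnti₀ hs0 hz.1.2
      have hB : (2 : ℝ) ^ (k + 1) / 2 ^ n ≤ min 1 (1 / z.2) := by
        refine le_min ((div_le_one (by positivity)).2 (pow_le_pow_right₀ one_le_two hk')) ?_
        rw [← one_div_div]
        exact one_div_le_one_div_of_le ht0 hz.2.2.le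
      calc (((2 ^ n)⁻¹ : ℝ≥0) : ℝ) = ((2 : ℝ) ^ (k + 1))⁻¹ * (2 ^ (k + 1) / 2 ^ n) := by
            push_cast
            field_simp
        _ < min 1 (1 / z.1) * min 1 (1 / z.2) :=
            mul_lt_mul hA hB (by positivity) (by positivity)
    have hmeas : (n : ℝ≥0∞) * ENNReal.ofReal (2 ^ n * 2⁻¹) ≤ volume
        {z ∈ quadrant | (((2 ^ n)⁻¹ : ℝ≥0) : ℝ≥0∞) < hardy₂ (D.indicator 1) z} := by
      refine le_trans (le_of_eq ?_) (measure_mono hsub)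
      rw [measure_biUnion_finset hdisj fun k _ => measurableSet_Ico.prod measurableSet_Ioo]
      simp [hRvol]
    calc (n : ℝ≥0∞) * 2⁻¹
        = (((2 ^ n)⁻¹ : ℝ≥0) : ℝ≥0∞) * ((n : ℝ≥0∞) * ENNReal.ofReal (2 ^ n * 2⁻¹)) := by
          rw [← ENNReal.ofReal_coe_nnreal, mul_left_comm, ← ENNReal.ofReal_mul (by positivity)]
          congr 1
          push_cast
          rw [inv_mul_cancel_left₀ (by positivity), ENNReal.ofReal_inv_of_pos two_pos,
            ENNReal.ofReal_ofNat]
      _ ≤ weakLpNorm 1 (fun _ => 1) (hardy₂ (D.indicator 1)) := by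
          refine le_iSup_of_le ((2 ^ n)⁻¹ : ℝ≥0) ?_
          simp only [ENNReal.coe_one, setLIntegral_one, div_one, ENNReal.rpow_one]
          gcongr
      _ ≤ C := h1
  obtain ⟨n, hn'⟩ := ENNReal.exists_nat_gt (r := (C : ℝ≥0∞) * 2)
    (ENNReal.mul_ne_top ENNReal.coe_ne_top (by simp))
  have h2 : (n : ℝ≥0∞) ≤ C * 2 := by
    have := hn n
    rwa [← div_eq_mul_inv, ENNReal.div_le_iff (by simp) (by simp)] at this
  exact absurd hn' (not_lt.2 h2)

/-! ### The endpoint `p = 1` for general weights -/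

theorem hardy₂_eq_setLIntegral {f : ℝ × ℝ → ℝ≥0∞}
    (hf : AEMeasurable f (volume.restrict quadrant)) (z : ℝ × ℝ) :
    hardy₂ f z = (ENNReal.ofReal (z.1 * z.2))⁻¹ * ∫⁻ x in Ioc 0 z.1 ×ˢ Ioc 0 z.2, f x := by
  have h1 : AEMeasurable f
      ((volume.restrict (Ioc 0 z.1)).prod (volume.restrict (Ioc 0 z.2))) := by
    rw [Measure.prod_restrict]
    exact hf.mono_measure (Measure.restrict_mono
      (prod_mono Ioc_subset_Ioi_self Ioc_subset_Ioi_self) le_rfl)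
  rw [hardy₂, Measure.volume_eq_prod, ← Measure.prod_restrict, lintegral_prod f h1]

/-- The kernel of the two-dimensional Hardy operator. -/
def hardyKernel (z x : ℝ × ℝ) : ℝ≥0∞ :=
  {q : (ℝ × ℝ) × (ℝ × ℝ) | q.2 ≤ q.1}.indicator
    (fun q => (ENNReal.ofReal (q.1.1 * q.1.2))⁻¹) (z, x)

theorem measurable_hardyKernel : Measurable (Function.uncurry hardyKernel) := by
  have h1 : Measurable fun q : (ℝ × ℝ) × (ℝ × ℝ) => (ENNReal.ofReal (q.1.1 * q.1.2))⁻¹ := by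
    fun_prop
  exact h1.indicator (measurableSet_le measurable_snd measurable_fst)

theorem hardy₂_eq_lintegral_kernel {f : ℝ × ℝ → ℝ≥0∞}
    (hf : AEMeasurable f (volume.restrict quadrant)) {z : ℝ × ℝ} (hz : z ∈ quadrant) :
    hardy₂ f z = ∫⁻ x in quadrant, hardyKernel z x * f x := by
  have hz' : ENNReal.ofReal (z.1 * z.2) ≠ 0 := by
    simpa using mul_pos (show 0 < z.1 from hz.1) hz.2
  have e : Ioc 0 z.1 ×ˢ Ioc 0 z.2 = Iic z ∩ quadrant := by
    ext x
    simp only [quadrant, mem_prod, mem_Ioc, mem_inter_iff, mem_Iic, mem_Ioi, Prod.le_def]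
    tauto
  rw [hardy₂_eq_setLIntegral hf, e, ← Measure.restrict_restrict measurableSet_Iic,
    ← lintegral_indicator measurableSet_Iic,
    ← lintegral_const_mul' _ _ (ENNReal.inv_ne_top.2 hz')]
  refine lintegral_congr fun x => ?_
  by_cases hx : x ≤ z <;> simp [hardyKernel, hx]

/-- The transpose of the Hardy operator applied to a weight. -/
def hardyDual (w : ℝ × ℝ → ℝ≥0) (x : ℝ × ℝ) : ℝ≥0∞ :=
  ∫⁻ z in quadrant, hardyKernel z x * (w z : ℝ≥0∞)

theorem lintegral_hardy₂_mul {w : ℝ × ℝ → ℝ≥0} (hw : IsWeight₂ w) {f : ℝ × ℝ → ℝ≥0∞}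
    (hf : AEMeasurable f (volume.restrict quadrant)) :
    ∫⁻ z in quadrant, hardy₂ f z * (w z : ℝ≥0∞) = ∫⁻ x in quadrant, f x * hardyDual w x := by
  unfold hardyDual
  rw [← lintegral_kernel_swap measurable_hardyKernel hf hw.aemeasurable]
  refine setLIntegral_congr_fun measurableSet_quadrant fun z hz => ?_
  simp only [hardy₂_eq_lintegral_kernel hf hz]

theorem aemeasurable_hardyDual {w : ℝ × ℝ → ℝ≥0} (hw : IsWeight₂ w) :
    AEMeasurable (hardyDual w) (volume.restrict quadrant) :=
  AEMeasurable.lintegral_prod_left'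
    (f := fun q : (ℝ × ℝ) × (ℝ × ℝ) => hardyKernel q.1 q.2 * (w q.1 : ℝ≥0∞))
    (measurable_hardyKernel.aemeasurable.mul hw.aemeasurable.comp_fst)

theorem memB₂_one_iff_decSup_lt_top {w : ℝ × ℝ → ℝ≥0} (hw : IsWeight₂ w) :
    MemB₂ 1 w ↔ decSup w < ∞ := by
  constructor
  · intro h
    obtain ⟨C, hC⟩ := h.lintegral_indicator_le one_pos
    refine lt_of_le_of_lt (iSup₂_le fun D hD => ?_) (ENNReal.coe_lt_top (r := C))
    by_cases hfin : ∫⁻ z in D, (w z : ℝ≥0∞) = ∞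
    · simp [hfin]
    · refine ENNReal.div_le_of_le_mul ?_
      simpa only [ENNReal.rpow_one] using hC D hD hfin
  · intro h
    set μ : Measure (ℝ × ℝ) := volume.restrict quadrant
    -- Enlarging the constant by `1` makes the bound hold for sets of infinite `w`-measure too.
    set C : ℝ≥0∞ := decSup w + 1 with hC
    have hCtop : C ≠ ∞ := by simp [hC, h.ne]
    have hD : ∀ D, IsDecSet D → ∫⁻ z in quadrant, hardy₂ (D.indicator 1) z * (w z : ℝ≥0∞) ≤
        C * ∫⁻ z in D, (w z : ℝ≥0∞) := by
      intro D hD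
      by_cases hfin : ∫⁻ z in D, (w z : ℝ≥0∞) = ∞
      · rw [hfin, ENNReal.mul_top (by simp [hC])]
        exact le_top
      · refine (ENNReal.div_le_iff_le_mul (.inr hCtop) (.inl hfin)).1 ?_
        exact le_trans (le_iSup₂_of_le D hD le_rfl) le_self_add
    have hwd := aemeasurable_hardyDual hw
    have hint : ∀ (a f : ℝ × ℝ → ℝ≥0∞), AEMeasurable a μ → AEMeasurable f μ →
        ∫⁻ z, f z ∂(μ.withDensity a) = ∫⁻ z, f z * a z ∂μ := fun a f ha hf => by
      rw [lintegral_withDensity_eq_lintegral_mul₀ ha hf]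
      exact lintegral_congr fun z => mul_comm _ _
    have hmono : ∀ f : ℝ × ℝ → ℝ≥0∞, AntitoneOn f quadrant →
        ∫⁻ z in quadrant, hardy₂ f z * (w z : ℝ≥0∞) ≤
          C * ∫⁻ z in quadrant, f z * (w z : ℝ≥0∞) := by
      intro f hf
      have hfm := aemeasurable_of_antitoneOn_quadrant hf
      rw [lintegral_hardy₂_mul hw hfm, ← hint _ _ hwd hfm, ← hint _ _ hw.aemeasurable hfm]
      refine lintegral_le_of_measure_lt_le (hfm.mono_ac (withDensity_absolutelyContinuous _ _))
        (hfm.mono_ac (withDensity_absolutelyContinuous _ _)) fun l _ => ?_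
      set E : Set (ℝ × ℝ) := {x | ENNReal.ofReal l < f x} ∩ quadrant
      have hE : IsDecSet E := isDecSet_iff.2 ⟨inter_subset_right, fun z hz z' hz' hzz =>
        ⟨lt_of_lt_of_le hz'.1 (hf hz hz'.2 hzz), hz⟩⟩
      have hmeas : ∀ a : ℝ × ℝ → ℝ≥0∞, AEMeasurable a μ →
          (μ.withDensity a) {x | ENNReal.ofReal l < f x} =
            ∫⁻ x in quadrant, E.indicator 1 x * a x := fun a ha => by
        rw [← hint _ _ ha (aemeasurable_of_antitoneOn_quadrant hE.antitoneOn)]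
        have hEn : NullMeasurableSet E (μ.withDensity a) :=
          (hE.nullMeasurableSet.mono_ac
            (Measure.absolutelyContinuous_of_le Measure.restrict_le_self)).mono_ac
            (withDensity_absolutelyContinuous _ _)
        rw [lintegral_indicator_one₀ hEn]
        refine measure_congr ((withDensity_absolutelyContinuous μ a).ae_le ?_)
        filter_upwards [ae_restrict_mem measurableSet_quadrant] with z hz
        exact propext ⟨fun h => ⟨h, hz⟩, fun h => h.1⟩
      rw [hmeas _ hwd, hmeas _ hw.aemeasurable,
        ← lintegral_hardy₂_mul hw (aemeasurable_of_antitoneOn_quadrant hE.antitoneOn)]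
      have h1 := setLIntegral_quadrant_indicator hE 1 one_pos w
      simp only [ENNReal.rpow_one] at h1
      rw [h1]
      exact hD E hE
    refine ⟨C.toNNReal, fun f hf => ?_⟩
    rw [ENNReal.coe_toNNReal hCtop]
    have h1 := hmono (fun z => (f z : ℝ≥0∞)) fun z hz z' hz' hzz =>
      ENNReal.coe_le_coe.2 (hf.1 hz hz' hzz)
    simpa only [lpNorm, ENNReal.rpow_one, div_one] using h1

/-! ### The decreasing rearrangement -/

/-- The distribution function is right-continuous, so it determines the superlevel sets of the
rearrangement exactly. -/
theorem lt_rearr_iff {g : ℝ → ℝ≥0∞} {t : ℝ} {l : ℝ≥0∞} :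
    l < rearr g t ↔ ENNReal.ofReal t < volume {x | l < g x} := by
  constructor
  · intro h
    by_contra hcon
    have h' : rearr g t ≤ l := sInf_le (show volume {x | l < g x} ≤ _ from not_lt.1 hcon)
    exact absurd h' (not_le.2 h)
  · intro h
    have hl : l < ∞ := by
      refine lt_top_iff_ne_top.2 fun hl => ?_
      simp [hl] at h
    obtain ⟨a, ha, hal, halim⟩ := exists_seq_strictAnti_tendsto' hl
    have hU : {x | l < g x} = ⋃ n, {x | a n < g x} := by
      ext x
      simp only [mem_ofPred_eq, mem_iUnion]
      constructor
      · intro hx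
        exact (halim.eventually_lt_const hx).exists
      · rintro ⟨n, hn⟩
        exact (hal n).1.trans hn
    have hmono : Monotone fun n => {x | a n < g x} := fun m n hmn x hx =>
      lt_of_le_of_lt (ha.antitone hmn) hx
    rw [hU, hmono.measure_iUnion, lt_iSup_iff] at h
    obtain ⟨n, hn⟩ := h
    refine lt_of_lt_of_le (hal n).1 (le_sInf fun σ hσ => ?_)
    by_contra! hcon
    refine absurd (hn.trans_le ?_) (not_lt.2 (show volume {x | σ < g x} ≤ _ from hσ))
    exact measure_mono fun x hx => hcon.trans hx

theorem rearr_antitone (g : ℝ → ℝ≥0∞) : Antitone (rearr g) := fun _ _ hst =>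
  sInf_le_sInf fun _ hσ => le_trans (show volume _ ≤ _ from hσ) (ENNReal.ofReal_le_ofReal hst)

theorem rearr_mono {g h : ℝ → ℝ≥0∞} (H : ∀ x, g x ≤ h x) (t : ℝ) : rearr g t ≤ rearr h t :=
  sInf_le_sInf fun σ hσ => le_trans (measure_mono fun x (hx : σ < g x) => hx.trans_le (H x))
    (show volume _ ≤ _ from hσ)

theorem measurable_rearr {α : Type*} [MeasurableSpace α] {F : α → ℝ → ℝ≥0∞}
    (hF : Measurable (Function.uncurry F)) :
    Measurable fun q : α × ℝ => rearr (F q.1) q.2 := by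
  refine measurable_of_Ioi fun c => ?_
  have h1 : Measurable fun x => volume (Prod.mk x ⁻¹' {q : α × ℝ | c < Function.uncurry F q}) :=
    measurable_measure_prodMk_left (measurableSet_lt measurable_const hF)
  have h2 : MeasurableSet {q : α × ℝ |
      ENNReal.ofReal q.2 < volume (Prod.mk q.1 ⁻¹' {q : α × ℝ | c < Function.uncurry F q})} :=
    measurableSet_lt (ENNReal.measurable_ofReal.comp measurable_snd) (h1.comp measurable_fst)
  convert h2 using 1
  ext q
  exact lt_rearr_iff

theorem measurable_rearrY {f : ℝ × ℝ → ℝ} (hf : Measurable f) :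
    Measurable fun q : ℝ × ℝ => rearrY f q.1 q.2 :=
  measurable_rearr (F := fun x y => ‖f (x, y)‖ₑ) hf.enorm

theorem measurable_rearrYX {f : ℝ × ℝ → ℝ} (hf : Measurable f) : Measurable (rearrYX f) := by
  have h1 := (measurable_rearrY hf).comp measurable_swap
  have h2 := (measurable_rearr (F := fun t x => rearrY f x t) h1).comp measurable_swap
  exact h2

theorem rearrYX_antitone (f : ℝ × ℝ → ℝ) : Antitone (rearrYX f) := fun _ _ hzz =>
  (rearr_antitone _ hzz.1).trans (rearr_mono (fun _ => rearr_antitone _ hzz.2) _)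

/-! ### A subadditive majorant of the rearrangement -/

/-- The quantity `inf_σ (t σ + ∫ (g - σ)₊)`. It equals `∫_0^t g^*`, but in this form it is
manifestly subadditive in `g` and needs no choice of optimal sets. -/
def kFun (t : ℝ) (g : ℝ → ℝ≥0∞) : ℝ≥0∞ :=
  ⨅ σ : ℝ≥0, ENNReal.ofReal t * σ + ∫⁻ x, (g x - σ)

theorem kFun_le {t : ℝ} (ht : 0 < t) (g : ℝ → ℝ≥0∞) (σ : ℝ≥0∞) :
    kFun t g ≤ ENNReal.ofReal t * σ + ∫⁻ x, (g x - σ) := by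
  induction σ with
  | top => simp [ENNReal.mul_top (ENNReal.ofReal_pos.2 ht).ne']
  | coe σ => exact iInf_le _ σ

theorem kFun_mono {g h : ℝ → ℝ≥0∞} (H : ∀ x, g x ≤ h x) (t : ℝ) : kFun t g ≤ kFun t h :=
  iInf_mono fun _ => add_le_add_right (lintegral_mono fun x => tsub_le_tsub_right (H x) _) _

theorem kFun_congr_ae {g h : ℝ → ℝ≥0∞} (H : g =ᵐ[volume] h) (t : ℝ) : kFun t g = kFun t h := by
  unfold kFun
  congr 1
  funext σ
  congr 1
  exact lintegral_congr_ae (by filter_upwards [H] with x hx; rw [hx])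

theorem kFun_add_le {g : ℝ → ℝ≥0∞} (hg : Measurable g) (h : ℝ → ℝ≥0∞) (t : ℝ) :
    kFun t (fun x => g x + h x) ≤ kFun t g + kFun t h := by
  simp only [kFun, ENNReal.iInf_add, ENNReal.add_iInf]
  refine le_iInf fun σ => le_iInf fun σ' => (iInf_le _ (σ' + σ)).trans ?_
  rw [add_add_add_comm, ← lintegral_add_left (hg.sub_const _), ← mul_add, ← ENNReal.coe_add]
  refine add_le_add le_rfl (lintegral_mono fun x => ?_)
  push_cast
  rw [tsub_le_iff_right]
  calc g x + h x ≤ (g x - σ' + σ') + (h x - σ + σ) := add_le_add le_tsub_add le_tsub_add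
    _ = _ := by ring

theorem kFun_const_mul_le (c : ℝ≥0) (g : ℝ → ℝ≥0∞) (t : ℝ) :
    kFun t (fun x => c * g x) ≤ c * kFun t g := by
  simp only [kFun]
  rw [ENNReal.mul_iInf (by simp)]
  refine le_iInf fun σ => (iInf_le _ (c * σ)).trans (le_of_eq ?_)
  rw [mul_add, ← lintegral_const_mul' _ _ ENNReal.coe_ne_top, mul_left_comm]
  push_cast
  congr 1
  exact lintegral_congr fun x => (ENNReal.mul_sub fun _ _ => ENNReal.coe_ne_top).symm

theorem le_kFun_const_mul {c : ℝ≥0} (hc : c ≠ 0) (g : ℝ → ℝ≥0∞) (t : ℝ) :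
    c * kFun t g ≤ kFun t (fun x => c * g x) := by
  have hc' : (c : ℝ≥0∞) ≠ 0 := by exact_mod_cast hc
  have h1 := kFun_const_mul_le c⁻¹ (fun x => c * g x) t
  simp only [ENNReal.coe_inv hc, ← mul_assoc, ENNReal.inv_mul_cancel hc' ENNReal.coe_ne_top,
    one_mul] at h1
  calc c * kFun t g ≤ c * ((c : ℝ≥0∞)⁻¹ * kFun t (fun x => c * g x)) := by gcongr
    _ = _ := by rw [← mul_assoc, ENNReal.mul_inv_cancel hc' ENNReal.coe_ne_top, one_mul]

theorem kFun_eq_iInf_rat (t : ℝ) (g : ℝ → ℝ≥0∞) :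
    kFun t g = ⨅ q : ℚ, (ENNReal.ofReal t * (Real.toNNReal q : ℝ≥0∞) +
      ∫⁻ x, (g x - (Real.toNNReal q : ℝ≥0∞))) := by
  refine le_antisymm (le_iInf fun q => iInf_le _ (Real.toNNReal q)) (le_iInf fun σ => ?_)
  refine ENNReal.le_of_forall_pos_le_add fun ε hε _ => ?_
  set T : ℝ≥0 := t.toNNReal with hT
  have hδ : 0 < ε / (T + 1) := by positivity
  obtain ⟨q, -, hq1, hq2⟩ := (NNReal.lt_iff_exists_rat_btwn σ (σ + ε / (T + 1))).1
    (lt_add_of_pos_right _ hδ)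
  refine (iInf_le _ q).trans ?_
  have h1 : T * Real.toNNReal q ≤ T * σ + ε := by
    calc T * Real.toNNReal q ≤ T * (σ + ε / (T + 1)) := by gcongr
      _ = T * σ + T * (ε / (T + 1)) := mul_add _ _ _
      _ ≤ T * σ + (T + 1) * (ε / (T + 1)) := by gcongr; exact le_self_add
      _ = T * σ + ε := by rw [mul_div_cancel₀]; positivity
  have h2 : ENNReal.ofReal t * (Real.toNNReal q : ℝ≥0∞) ≤ ENNReal.ofReal t * σ + ε := by
    change (T : ℝ≥0∞) * _ ≤ (T : ℝ≥0∞) * _ + _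
    exact_mod_cast h1
  rw [add_right_comm]
  refine add_le_add h2 (lintegral_mono fun x => tsub_le_tsub_left ?_ _)
  exact ENNReal.coe_le_coe.2 hq1.le

theorem measurable_kFun {α : Type*} [MeasurableSpace α] {F : α → ℝ → ℝ≥0∞}
    (hF : Measurable (Function.uncurry F)) :
    Measurable fun q : ℝ × α => kFun q.1 (F q.2) := by
  simp only [kFun_eq_iInf_rat]
  refine Measurable.iInf fun q => ?_
  have h1 : Measurable fun a => ∫⁻ x, (F a x - (Real.toNNReal q : ℝ≥0∞)) :=
    Measurable.lintegral_prod_right' (f := fun b : α × ℝ => Function.uncurry F b - (Real.toNNReal q : ℝ≥0∞))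
      (hF.sub_const _)
  exact ((ENNReal.measurable_ofReal.comp measurable_fst).mul_const _).add (h1.comp measurable_snd)

theorem mul_rearr_le_kFun {g : ℝ → ℝ≥0∞} (hg : Measurable g) (t : ℝ) :
    ENNReal.ofReal t * rearr g t ≤ kFun t g := by
  refine le_iInf fun σ => ?_
  have h1 : ENNReal.ofReal t * (rearr g t - σ) ≤ ∫⁻ x, (g x - σ) := by
    rw [lintegral_eq_lintegral_measure_lt volume (hg.sub_const _).aemeasurable]
    conv_lhs => rw [← volume_ofReal_lt (rearr g t - σ)]
    have hS : MeasurableSet {l : ℝ | ENNReal.ofReal l < rearr g t - σ} :=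
      measurableSet_lt ENNReal.measurable_ofReal measurable_const
    rw [← setLIntegral_const]
    refine (setLIntegral_mono' hS fun l hl => ?_).trans (setLIntegral_le_lintegral _ _)
    have hl' : σ + ENNReal.ofReal l < rearr g t := lt_tsub_iff_left.1 hl
    refine (lt_rearr_iff.1 hl').le.trans (measure_mono fun x hx => ?_)
    have hx' : σ + ENNReal.ofReal l < g x := hx
    exact lt_tsub_iff_left.2 hx'
  calc ENNReal.ofReal t * rearr g t ≤ ENNReal.ofReal t * (σ + (rearr g t - σ)) := by
        gcongr
        exact le_add_tsub
    _ ≤ _ := by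
        rw [mul_add]
        gcongr

/-- The value `σ = g^*(t)` is optimal in `kFun t g`. -/
theorem mul_rearr_add_lintegral_le {g : ℝ → ℝ≥0∞} (hg : Measurable g) (t : ℝ) :
    ENNReal.ofReal t * rearr g t + ∫⁻ x, (g x - rearr g t) ≤ ∫⁻ τ in Ioc 0 t, rearr g τ := by
  set σ := rearr g t with hσ
  have hm : Measurable (rearr g) := (rearr_antitone g).measurable
  have h1 : ∫⁻ x, (g x - σ) ≤ ∫⁻ τ in Ioc 0 t, (rearr g τ - σ) := by
    rw [lintegral_eq_lintegral_measure_lt volume (hg.sub_const _).aemeasurable,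
      lintegral_eq_lintegral_measure_lt _ (hm.sub_const _).aemeasurable]
    refine lintegral_mono fun l => ?_
    simp only [lt_tsub_iff_left]
    set V := volume {x | σ + ENNReal.ofReal l < g x} with hV
    have hVt : V ≤ ENNReal.ofReal t := by
      by_contra! hcon
      exact absurd (lt_rearr_iff.2 hcon) (not_lt.2 (hσ ▸ le_self_add))
    rw [← volume_ofReal_lt V, Measure.restrict_apply' measurableSet_Ioi,
      Measure.restrict_apply' measurableSet_Ioc]
    refine measure_mono fun τ hτ => ⟨lt_rearr_iff.2 hτ.1, hτ.2, ?_⟩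
    exact ((ENNReal.ofReal_lt_ofReal_iff_of_nonneg (le_of_lt hτ.2)).1
      (lt_of_lt_of_le hτ.1 hVt)).le
  have h2 : ENNReal.ofReal t * σ = ∫⁻ _ in Ioc 0 t, σ := by
    rw [setLIntegral_const, Real.volume_Ioc, sub_zero, mul_comm]
  calc ENNReal.ofReal t * σ + ∫⁻ x, (g x - σ)
      ≤ (∫⁻ _ in Ioc 0 t, σ) + ∫⁻ τ in Ioc 0 t, (rearr g τ - σ) := by
        rw [h2]
        gcongr
    _ = ∫⁻ τ in Ioc 0 t, (σ + (rearr g τ - σ)) := (lintegral_add_left measurable_const _).symm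
    _ = ∫⁻ τ in Ioc 0 t, rearr g τ := by
        refine setLIntegral_congr_fun measurableSet_Ioc fun τ hτ => ?_
        exact add_tsub_cancel_of_le (rearr_antitone g hτ.2)

theorem kFun_le_lintegral_rearr {g : ℝ → ℝ≥0∞} (hg : Measurable g) {t : ℝ} (ht : 0 < t) :
    kFun t g ≤ ∫⁻ τ in Ioc 0 t, rearr g τ :=
  (kFun_le ht g _).trans (mul_rearr_add_lintegral_le hg t)

/-- The maximal function
`(st)⁻¹ sup_{|E| ≤ s} ∫_E sup_{|F| ≤ t} ∫_F |f(x,y)| dy dx`, with the suprema over sets written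
through `kFun`. -/
def maxRearr (f : ℝ × ℝ → ℝ) (z : ℝ × ℝ) : ℝ≥0∞ :=
  (ENNReal.ofReal (z.1 * z.2))⁻¹ * kFun z.1 fun x => kFun z.2 fun y => ‖f (x, y)‖ₑ

theorem measurable_kFun_snd {f : ℝ × ℝ → ℝ} (hf : Measurable f) :
    Measurable fun q : ℝ × ℝ => kFun q.1 fun y => ‖f (q.2, y)‖ₑ :=
  measurable_kFun (F := fun x y => ‖f (x, y)‖ₑ) hf.enorm

theorem measurable_maxRearr {f : ℝ × ℝ → ℝ} (hf : Measurable f) : Measurable (maxRearr f) := by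
  refine Measurable.mul (by fun_prop) ?_
  exact measurable_kFun (F := fun t x => kFun t fun y => ‖f (x, y)‖ₑ)
    (measurable_kFun_snd hf)

theorem ae_ae_eq {f g : ℝ × ℝ → ℝ} (h : f =ᵐ[volume] g) :
    ∀ᵐ x : ℝ, (fun y => ‖f (x, y)‖ₑ) =ᵐ[volume] fun y => ‖g (x, y)‖ₑ := by
  rw [Measure.volume_eq_prod] at h
  filter_upwards [Measure.ae_ae_of_ae_prod h] with x hx
  filter_upwards [hx] with y hy
  rw [hy]

theorem maxRearr_congr {f g : ℝ × ℝ → ℝ} (h : f =ᵐ[volume] g) : maxRearr f = maxRearr g := by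
  funext z
  unfold maxRearr
  congr 1
  refine kFun_congr_ae ?_ _
  filter_upwards [ae_ae_eq h] with x hx
  exact kFun_congr_ae hx _

theorem maxRearr_add_le {f : ℝ × ℝ → ℝ} (hf : Measurable f) (g : ℝ × ℝ → ℝ) (z : ℝ × ℝ) :
    maxRearr (f + g) z ≤ maxRearr f z + maxRearr g z := by
  unfold maxRearr
  rw [← mul_add]
  gcongr 1
  have hm := (measurable_kFun_snd hf).comp (measurable_prodMk_left (x := z.2))
  have h1 : ∀ x, kFun z.2 (fun y => ‖(f + g) (x, y)‖ₑ) ≤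
      kFun z.2 (fun y => ‖f (x, y)‖ₑ) + kFun z.2 (fun y => ‖g (x, y)‖ₑ) := fun x => by
    have hx : Measurable fun y => ‖f (x, y)‖ₑ := (hf.comp measurable_prodMk_left).enorm
    have h2 : kFun z.2 (fun y => ‖(f + g) (x, y)‖ₑ) ≤
        kFun z.2 fun y => ‖f (x, y)‖ₑ + ‖g (x, y)‖ₑ :=
      kFun_mono (fun y => enorm_add_le (f (x, y)) (g (x, y))) z.2
    exact h2.trans (kFun_add_le hx (fun y => ‖g (x, y)‖ₑ) z.2)
  exact (kFun_mono h1 z.1).trans (kFun_add_le hm _ z.1)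

theorem maxRearr_smul_le (c : ℝ) (f : ℝ × ℝ → ℝ) (z : ℝ × ℝ) :
    maxRearr (c • f) z ≤ (‖c‖₊ : ℝ≥0∞) * maxRearr f z := by
  unfold maxRearr
  rw [mul_left_comm]
  gcongr 1
  refine le_trans (kFun_mono (fun x => ?_) _) (kFun_const_mul_le _ _ _)
  refine le_trans (kFun_mono (fun y => le_of_eq ?_) _) (kFun_const_mul_le _ _ _)
  simp [enorm_eq_nnnorm]

theorem rearrYX_le_maxRearr {f : ℝ × ℝ → ℝ} (hf : Measurable f) {z : ℝ × ℝ}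
    (hz : z ∈ quadrant) : rearrYX f z ≤ maxRearr f z := by
  have hs : 0 < z.1 := hz.1
  have ht : 0 < z.2 := hz.2
  have hst : ENNReal.ofReal (z.1 * z.2) ≠ 0 := by simpa using mul_pos hs ht
  have h1 : ENNReal.ofReal (z.1 * z.2) * rearrYX f z ≤
      kFun z.1 fun x => kFun z.2 fun y => ‖f (x, y)‖ₑ := by
    calc ENNReal.ofReal (z.1 * z.2) * rearrYX f z
        = ENNReal.ofReal z.2 * (ENNReal.ofReal z.1 * rearr (fun x => rearrY f x z.2) z.1) := by
          rw [ENNReal.ofReal_mul hs.le, rearrYX]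
          ring
      _ ≤ ENNReal.ofReal z.2 * kFun z.1 (fun x => rearrY f x z.2) := by
          gcongr
          exact mul_rearr_le_kFun ((measurable_rearrY hf).comp measurable_prodMk_right) _
      _ ≤ kFun z.1 (fun x => ENNReal.ofReal z.2 * rearrY f x z.2) :=
          le_kFun_const_mul (c := z.2.toNNReal) (by simpa using ht) _ _
      _ ≤ _ := kFun_mono (fun x => mul_rearr_le_kFun
          (hf.comp measurable_prodMk_left).enorm _) _
  calc rearrYX f z
      = (ENNReal.ofReal (z.1 * z.2))⁻¹ * (ENNReal.ofReal (z.1 * z.2) * rearrYX f z) := by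
        rw [← mul_assoc, ENNReal.inv_mul_cancel hst ENNReal.ofReal_ne_top, one_mul]
    _ ≤ maxRearr f z := by
        unfold maxRearr
        gcongr

/-- The maximal function is dominated by the Hardy transform of the rearrangement: in the outer
`kFun` the competitor is `∫_0^t f_yx^*(s,τ) dτ`, an average of the optimal levels for each `τ`. -/
theorem maxRearr_le_hardy₂ {f : ℝ × ℝ → ℝ} (hf : Measurable f) {z : ℝ × ℝ}
    (hz : z ∈ quadrant) : maxRearr f z ≤ hardy₂ (rearrYX f) z := by
  have hs : 0 < z.1 := hz.1
  have ht : 0 < z.2 := hz.2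
  have hY := measurable_rearrY hf
  have hYX := measurable_rearrYX hf
  unfold maxRearr hardy₂
  gcongr 1
  rw [lintegral_lintegral_swap (f := fun σ τ => rearrYX f (σ, τ)) hYX.aemeasurable]
  have hr : Measurable fun τ => rearrYX f (z.1, τ) := hYX.comp measurable_prodMk_left
  have hsub : Measurable fun q : ℝ × ℝ => rearrY f q.1 q.2 - rearrYX f (z.1, q.2) :=
    hY.sub (hr.comp measurable_snd)
  calc kFun z.1 (fun x => kFun z.2 fun y => ‖f (x, y)‖ₑ)
      ≤ kFun z.1 (fun x => ∫⁻ τ in Ioc 0 z.2, rearrY f x τ) :=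
        kFun_mono (fun x => kFun_le_lintegral_rearr (hf.comp measurable_prodMk_left).enorm ht) _
    _ ≤ ENNReal.ofReal z.1 * (∫⁻ τ in Ioc 0 z.2, rearrYX f (z.1, τ)) +
          ∫⁻ x, ((∫⁻ τ in Ioc 0 z.2, rearrY f x τ) -
            ∫⁻ τ in Ioc 0 z.2, rearrYX f (z.1, τ)) := kFun_le hs _ _
    _ ≤ ENNReal.ofReal z.1 * (∫⁻ τ in Ioc 0 z.2, rearrYX f (z.1, τ)) +
          ∫⁻ x, ∫⁻ τ in Ioc 0 z.2, (rearrY f x τ - rearrYX f (z.1, τ)) := by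
        gcongr with x
        exact lintegral_sub_le _ _ hr
    _ = ∫⁻ τ in Ioc 0 z.2, (ENNReal.ofReal z.1 * rearrYX f (z.1, τ) +
          ∫⁻ x, (rearrY f x τ - rearrYX f (z.1, τ))) := by
        rw [lintegral_lintegral_swap
          (f := fun x τ => rearrY f x τ - rearrYX f (z.1, τ)) hsub.aemeasurable,
          ← lintegral_const_mul _ hr, ← lintegral_add_left (hr.const_mul _)]
    _ ≤ ∫⁻ τ in Ioc 0 z.2, ∫⁻ σ in Ioc 0 z.1, rearrYX f (σ, τ) :=
        lintegral_mono fun τ =>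
          mul_rearr_add_lintegral_le (hY.comp measurable_prodMk_right) z.1

theorem ae_eq_zero_of_rearrYX_eq_zero {f : ℝ × ℝ → ℝ} (hf : Measurable f)
    (h : ∀ z ∈ quadrant, rearrYX f z = 0) : f =ᵐ[volume] 0 := by
  have h1 : ∀ t : ℝ, 0 < t → ∀ᵐ x : ℝ, rearrY f x t = 0 := by
    intro t ht
    rw [ae_iff]
    refine le_antisymm (ENNReal.le_of_forall_pos_le_add fun ε hε _ => ?_) bot_le
    have h2 := h (ε, t) (mk_mem_quadrant (by exact_mod_cast hε) ht)
    have h3 : ¬ (0 < rearr (fun x => rearrY f x t) ε) := not_lt.2 (le_of_eq h2)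
    rw [lt_rearr_iff, not_lt, ENNReal.ofReal_coe_nnreal] at h3
    simpa [pos_iff_ne_zero] using h3
  have h2 : ∀ᵐ x : ℝ, ∀ n : ℕ, rearrY f x (1 / ((n : ℝ) + 1)) = 0 :=
    ae_all_iff.2 fun n => h1 _ Nat.one_div_pos_of_nat
  have hS : MeasurableSet {q : ℝ × ℝ | ¬ f q = 0} :=
    (hf (measurableSet_singleton 0)).compl
  rw [Filter.EventuallyEq, ae_iff, Measure.volume_eq_prod]
  refine (Measure.measure_prod_null hS).2 ?_
  filter_upwards [h2] with x hx
  refine le_antisymm (ENNReal.le_of_forall_pos_le_add fun ε hε _ => ?_) bot_le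
  obtain ⟨n, hn⟩ := exists_nat_one_div_lt (K := ℝ) (ε := ε) (by exact_mod_cast hε)
  have h3 : ¬ (0 < rearr (fun y => ‖f (x, y)‖ₑ) (1 / ((n : ℝ) + 1))) := not_lt.2 (le_of_eq (hx n))
  rw [lt_rearr_iff, not_lt] at h3
  rw [Pi.zero_apply, zero_add, ← ENNReal.ofReal_coe_nnreal]
  refine le_trans ?_ (h3.trans (ENNReal.ofReal_le_ofReal hn.le))
  refine measure_mono fun y hy => ?_
  have hy' : f (x, y) ≠ 0 := hy
  simpa [pos_iff_ne_zero] using hy'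

/-! ### Normability -/

theorem lpNorm_mono {p : ℝ} (hp : 0 < p) {w : ℝ × ℝ → ℝ≥0} {g h : ℝ × ℝ → ℝ≥0∞}
    (H : ∀ z ∈ quadrant, g z ≤ h z) : lpNorm p w g ≤ lpNorm p w h := by
  unfold lpNorm
  refine ENNReal.rpow_le_rpow (setLIntegral_mono' measurableSet_quadrant fun z hz => ?_)
    (by positivity)
  gcongr
  exact H z hz

theorem lpNorm_add_le {p : ℝ} (hp : 1 ≤ p) {w : ℝ × ℝ → ℝ≥0} (hw : IsWeight₂ w)
    {g h : ℝ × ℝ → ℝ≥0∞} (hg : Measurable g) (hh : Measurable h) :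
    lpNorm p w (fun z => g z + h z) ≤ lpNorm p w g + lpNorm p w h := by
  have hp0 : 0 < p := by linarith
  have hwm := hw.aemeasurable.pow_const (1 / p)
  have h1 := ENNReal.lintegral_Lp_add_le (hg.aemeasurable.mul hwm) (hh.aemeasurable.mul hwm) hp
  simpa only [lpNorm, Pi.add_apply, Pi.mul_apply, ← add_mul, mul_rpow_one_div_rpow hp0] using h1

theorem lpNorm_const_mul {p : ℝ} (hp : 0 < p) (w : ℝ × ℝ → ℝ≥0) (c : ℝ≥0)
    (g : ℝ × ℝ → ℝ≥0∞) : lpNorm p w (fun z => c * g z) = c * lpNorm p w g := by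
  have hc : (c : ℝ≥0∞) ^ p ≠ ∞ := ENNReal.rpow_ne_top_of_nonneg hp.le ENNReal.coe_ne_top
  simp only [lpNorm, ENNReal.mul_rpow_of_nonneg _ _ hp.le, mul_assoc]
  rw [lintegral_const_mul' _ _ hc, ENNReal.mul_rpow_of_nonneg _ _ (by positivity),
    ← ENNReal.rpow_mul, mul_one_div_cancel hp.ne', ENNReal.rpow_one]

/-- The `B_p^{(2)}` inequality is stated for finite-valued functions; monotone convergence along
the truncations `min F n` extends it to `[0,∞]`-valued ones. -/
theorem MemB₂.exists_bound {p : ℝ} (hp : 0 < p) {w : ℝ × ℝ → ℝ≥0} (hw : IsWeight₂ w)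
    (h : MemB₂ p w) : ∃ C : ℝ≥0, ∀ F : ℝ × ℝ → ℝ≥0∞, Measurable F → AntitoneOn F quadrant →
      lpNorm p w F < ∞ → lpNorm p w (hardy₂ F) ≤ C * lpNorm p w F := by
  obtain ⟨C, hC⟩ := h
  refine ⟨C, fun F hF hanti hfin => ?_⟩
  set G : ℕ → ℝ × ℝ → ℝ≥0∞ := fun n z => min (F z) n with hG
  have hGm : ∀ n, Measurable (G n) := fun n => hF.min measurable_const
  have hGmono : ∀ z, Monotone fun n => G n z := fun z m n hmn =>
    min_le_min le_rfl (by exact_mod_cast hmn)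
  have hGanti : ∀ n, AntitoneOn (G n) quadrant := fun n z hz z' hz' hzz =>
    min_le_min (hanti hz hz' hzz) le_rfl
  have hGsup : ∀ z, F z = ⨆ n, G n z := fun z => by
    simp only [hG]
    rw [← inf_iSup_eq, ENNReal.iSup_natCast]
    exact (inf_top_eq (F z)).symm
  have hS : ∀ z, hardy₂ F z = ⨆ n, hardy₂ (G n) z := fun z => by
    rw [hardy₂_eq_setLIntegral hF.aemeasurable]
    simp only [hardy₂_eq_setLIntegral (hGm _).aemeasurable]
    rw [← ENNReal.mul_iSup, ← lintegral_iSup hGm fun m n hmn z => hGmono z hmn]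
    simp only [← hGsup]
  have hSmono : ∀ z, Monotone fun n => hardy₂ (G n) z := fun z m n hmn => by
    exact mul_le_mul_right (lintegral_mono fun σ => lintegral_mono fun τ => hGmono _ hmn) _
  have hbound : ∀ n, ∫⁻ z in quadrant, hardy₂ (G n) z ^ p * (w z : ℝ≥0∞) ≤
      (C : ℝ≥0∞) ^ p * ∫⁻ z in quadrant, F z ^ p * (w z : ℝ≥0∞) := by
    intro n
    have hcoe : ∀ z, (((G n z).toNNReal : ℝ≥0) : ℝ≥0∞) = G n z := fun z =>
      ENNReal.coe_toNNReal (ne_top_of_le_ne_top (ENNReal.natCast_ne_top n) (min_le_right _ _))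
    have hle : lpNorm p w (G n) ≤ lpNorm p w F := lpNorm_mono hp fun z _ => min_le_left _ _
    have h1 := hC (fun z => (G n z).toNNReal) ⟨fun z hz z' hz' hzz => by
      rw [← ENNReal.coe_le_coe, hcoe, hcoe]
      exact hGanti n hz hz' hzz, by simpa only [hcoe] using hle.trans_lt hfin⟩
    simp only [hcoe] at h1
    refine rpow_le_rpow_of_lpNorm_le hp (h1.trans ?_)
    gcongr
  have hmain : ∫⁻ z in quadrant, hardy₂ F z ^ p * (w z : ℝ≥0∞) ≤
      (C : ℝ≥0∞) ^ p * ∫⁻ z in quadrant, F z ^ p * (w z : ℝ≥0∞) := by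
    have e : ∀ z, hardy₂ F z ^ p * (w z : ℝ≥0∞) =
        ⨆ n, hardy₂ (G n) z ^ p * (w z : ℝ≥0∞) := fun z => by
      rw [hS z, ← ENNReal.iSup_mul]
      congr 1
      exact (ENNReal.orderIsoRpow p hp).map_iSup _
    simp only [e]
    rw [lintegral_iSup' (f := fun n z => hardy₂ (G n) z ^ p * (w z : ℝ≥0∞))
      (fun n => ((aemeasurable_of_antitoneOn_quadrant
      (antitoneOn_hardy₂ (hGanti n))).pow_const p).mul hw.aemeasurable)
      (.of_forall fun z m n hmn =>
        mul_le_mul_left (ENNReal.rpow_le_rpow (hSmono z hmn) hp.le) _)]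
    exact iSup_le hbound
  have h2 := lpNorm_le_of_lintegral_le hp hmain
  rwa [← ENNReal.rpow_mul, mul_one_div_cancel hp.ne', ENNReal.rpow_one] at h2

/-- Definiteness. The boundedness of the Hardy operator is needed here: it turns the vanishing of
the rearrangement on the support of the weight into its vanishing near the origin. -/
theorem ae_eq_zero_of_lpNorm_hardy₂_eq_zero {p : ℝ} (hp : 0 < p) {w : ℝ × ℝ → ℝ≥0}
    (hw : IsWeight₂ w) (hw0 : ¬ (w =ᵐ[volume.restrict quadrant] 0)) {f : ℝ × ℝ → ℝ}
    (hf : Measurable f) (h : lpNorm p w (hardy₂ (rearrYX f)) = 0) : f =ᵐ[volume] 0 := by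
  have hYX := measurable_rearrYX hf
  have hanti := rearrYX_antitone f
  have hm : AEMeasurable (hardy₂ (rearrYX f)) (volume.restrict quadrant) :=
    aemeasurable_of_antitoneOn_quadrant (antitoneOn_hardy₂ (hanti.antitoneOn _))
  obtain ⟨z, hz, hz0⟩ : ∃ z ∈ quadrant, hardy₂ (rearrYX f) z = 0 := by
    by_contra! hcon
    refine hw0 ?_
    rw [lpNorm, ENNReal.rpow_eq_zero_iff_of_pos (by positivity)] at h
    filter_upwards [(lintegral_eq_zero_iff' ((hm.pow_const p).mul hw.aemeasurable)).1 h,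
      ae_restrict_mem measurableSet_quadrant] with z hz hzq
    rcases mul_eq_zero.1 hz with h1 | h1
    · exact absurd ((ENNReal.rpow_eq_zero_iff_of_pos hp).1 h1) (hcon z hzq)
    · simpa using h1
  refine ae_eq_zero_of_rearrYX_eq_zero hf fun a ha => ?_
  rw [hardy₂_eq_setLIntegral hYX.aemeasurable] at hz0
  have h2 := (mul_eq_zero.1 hz0).resolve_left (ENNReal.inv_ne_zero.2 ENNReal.ofReal_ne_top)
  by_contra hne
  have hb1 : 0 < min a.1 z.1 := lt_min ha.1 hz.1
  have hb2 : 0 < min a.2 z.2 := lt_min ha.2 hz.2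
  have h3 : rearrYX f a * (ENNReal.ofReal (min a.1 z.1) * ENNReal.ofReal (min a.2 z.2)) ≤ 0 := by
    rw [← h2]
    calc rearrYX f a * (ENNReal.ofReal (min a.1 z.1) * ENNReal.ofReal (min a.2 z.2))
        = ∫⁻ _ in Ioc 0 (min a.1 z.1) ×ˢ Ioc 0 (min a.2 z.2), rearrYX f a := by
          rw [setLIntegral_const, Measure.volume_eq_prod, Measure.prod_prod, Real.volume_Ioc,
            Real.volume_Ioc, sub_zero, sub_zero]
      _ ≤ ∫⁻ x in Ioc 0 (min a.1 z.1) ×ˢ Ioc 0 (min a.2 z.2), rearrYX f x := by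
          refine setLIntegral_mono' (measurableSet_Ioc.prod measurableSet_Ioc) fun x hx => hanti ?_
          exact ⟨hx.1.2.trans (min_le_left _ _), hx.2.2.trans (min_le_left _ _)⟩
      _ ≤ _ := lintegral_mono_set (prod_mono (Ioc_subset_Ioc_right (min_le_right _ _))
          (Ioc_subset_Ioc_right (min_le_right _ _)))
  have h4 : rearrYX f a * (ENNReal.ofReal (min a.1 z.1) * ENNReal.ofReal (min a.2 z.2)) ≠ 0 :=
    mul_ne_zero hne (mul_ne_zero (ENNReal.ofReal_pos.2 hb1).ne' (ENNReal.ofReal_pos.2 hb2).ne')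
  exact h4 (le_antisymm h3 bot_le)

theorem lorentzNormable_of_memB₂ {p : ℝ} (hp : 1 ≤ p) {w : ℝ × ℝ → ℝ≥0} (hw : IsWeight₂ w)
    (hw0 : ¬ (w =ᵐ[volume.restrict quadrant] 0)) (hB : MemB₂ p w) : LorentzNormable p w := by
  have hp0 : 0 < p := by linarith
  obtain ⟨C, hC⟩ := hB.exists_bound hp0 hw
  set n : ((ℝ × ℝ) →ₘ[volume] ℝ) → ℝ≥0∞ := fun f => lpNorm p w (maxRearr f) with hn
  have hmeas : ∀ f : (ℝ × ℝ) →ₘ[volume] ℝ, Measurable f := fun f => f.measurable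
  have hlow : ∀ f : (ℝ × ℝ) →ₘ[volume] ℝ, lorentzNorm p w f ≤ n f := fun f =>
    lpNorm_mono hp0 fun z hz => rearrYX_le_maxRearr (hmeas f) hz
  have hhardy : ∀ f : (ℝ × ℝ) →ₘ[volume] ℝ, lorentzNorm p w f < ∞ →
      lpNorm p w (hardy₂ (rearrYX f)) ≤ C * lorentzNorm p w f := fun f hf =>
    hC _ (measurable_rearrYX (hmeas f)) ((rearrYX_antitone f).antitoneOn _) hf
  have hup : ∀ f : (ℝ × ℝ) →ₘ[volume] ℝ, lorentzNorm p w f < ∞ →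
      n f ≤ C * lorentzNorm p w f := fun f hf =>
    (lpNorm_mono hp0 fun z hz => maxRearr_le_hardy₂ (hmeas f) hz).trans (hhardy f hf)
  have hntop : ∀ f : (ℝ × ℝ) →ₘ[volume] ℝ, lorentzNorm p w f < ∞ → n f < ∞ := fun f hf =>
    (hup f hf).trans_lt (ENNReal.mul_lt_top ENNReal.coe_lt_top hf)
  have hadd : ∀ f g : (ℝ × ℝ) →ₘ[volume] ℝ, n (f + g) ≤ n f + n g := fun f g => by
    simp only [hn]
    rw [maxRearr_congr (AEEqFun.coeFn_add f g)]
    exact (lpNorm_mono hp0 fun z _ => maxRearr_add_le (hmeas f) g z).trans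
      (lpNorm_add_le hp hw (measurable_maxRearr (hmeas f)) (measurable_maxRearr (hmeas g)))
  have hsmul : ∀ (c : ℝ) (f : (ℝ × ℝ) →ₘ[volume] ℝ), n (c • f) ≤ (‖c‖₊ : ℝ≥0∞) * n f :=
    fun c f => by
      simp only [hn]
      rw [maxRearr_congr (AEEqFun.coeFn_smul c f), ← lpNorm_const_mul hp0]
      exact lpNorm_mono hp0 fun z _ => maxRearr_smul_le c f z
  have hzero : n 0 = 0 := by
    have := hsmul 0 0
    simpa using this
  let V : Submodule ℝ ((ℝ × ℝ) →ₘ[volume] ℝ) :=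
    { carrier := {f | lorentzNorm p w f < ∞}
      add_mem' := fun {f g} hf hg => lt_of_le_of_lt ((hlow _).trans (hadd f g))
        (ENNReal.add_lt_top.2 ⟨hntop f hf, hntop g hg⟩)
      zero_mem' := lt_of_le_of_lt (hlow 0) (by rw [hzero]; exact ENNReal.zero_lt_top)
      smul_mem' := fun c f hf => lt_of_le_of_lt ((hlow _).trans (hsmul c f))
        (ENNReal.mul_lt_top ENNReal.coe_lt_top (hntop f hf)) }
  have hV : ∀ f : V, n f ≠ ∞ := fun f => (hntop f f.2).ne
  let N : Seminorm ℝ V := Seminorm.ofSMulLE (fun f => (n f).toReal)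
    (by simp [hzero])
    (fun f g => by
      rw [← ENNReal.toReal_add (hV f) (hV g)]
      exact ENNReal.toReal_mono (ENNReal.add_ne_top.2 ⟨hV f, hV g⟩) (hadd f g))
    (fun c f => by
      rw [← coe_nnnorm, ← ENNReal.coe_toReal, ← ENNReal.toReal_mul]
      exact ENNReal.toReal_mono (ENNReal.mul_ne_top ENNReal.coe_ne_top (hV f)) (hsmul c f))
  have hN : ∀ f : V, ENNReal.ofReal (N f) = n f := fun f => ENNReal.ofReal_toReal (hV f)
  refine ⟨V, fun f => Iff.rfl, N, fun f hf => ?_, 1, C + 1, one_pos, by positivity, fun f => ?_⟩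
  · have h1 : n f = 0 := by rw [← hN f, hf, ENNReal.ofReal_zero]
    have h2 : lorentzNorm p w (f : (ℝ × ℝ) →ₘ[volume] ℝ) = 0 :=
      le_antisymm ((hlow f).trans_eq h1) bot_le
    have h3 : lpNorm p w (hardy₂ (rearrYX (f : (ℝ × ℝ) →ₘ[volume] ℝ))) = 0 := by
      have := hhardy f f.2
      rw [h2, mul_zero] at this
      exact le_antisymm this bot_le
    have h4 := ae_eq_zero_of_lpNorm_hardy₂_eq_zero hp0 hw hw0 (hmeas f) h3
    exact Subtype.ext (AEEqFun.ext (h4.trans AEEqFun.coeFn_zero.symm))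
  · rw [hN f]
    refine ⟨by simpa using hlow f, (hup f f.2).trans ?_⟩
    gcongr
    exact_mod_cast le_self_add

end Lorentz2

end

theorem theorem2p8 (p : ℝ) (hp : 1 ≤ p) :
    (∀ w : ℝ × ℝ → ℝ≥0, Lorentz2.IsWeight₂ w →
      ¬ (w =ᵐ[volume.restrict Lorentz2.quadrant] 0) →
      Lorentz2.MemB₂ p w → Lorentz2.LorentzNormable p w) ∧
    (∀ w : ℝ × ℝ → ℝ≥0, Lorentz2.IsWeight₂ w →
      (Lorentz2.MemB₂ 1 w ↔ Lorentz2.decSup w < ∞)) ∧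
    (∀ u v : ℝ → ℝ≥0, Lorentz2.IsWeight u → Lorentz2.IsWeight v →
      ¬ (u =ᵐ[volume.restrict (Ioi 0)] 0) → ¬ (v =ᵐ[volume.restrict (Ioi 0)] 0) →
      Lorentz2.decSup (Lorentz2.prodWeight u v) =
        (1 + Lorentz2.tailSup u) * (1 + Lorentz2.tailSup v)) ∧
    (∀ u v : ℝ → ℝ≥0, Lorentz2.IsWeight u → Lorentz2.IsWeight v →
      ¬ (u =ᵐ[volume.restrict (Ioi 0)] 0) → ¬ (v =ᵐ[volume.restrict (Ioi 0)] 0) →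
      (Lorentz2.MemB₂ p (Lorentz2.prodWeight u v) ↔
        Lorentz2.MemB p u ∧ Lorentz2.MemB p v)) ∧
    (¬ Lorentz2.MemB₂Weak 1 (fun _ => 1) ∧ Lorentz2.MemBOneWeak (fun _ => 1)) :=
  ⟨fun _ hw hw0 hB => Lorentz2.lorentzNormable_of_memB₂ hp hw hw0 hB,
    fun _ hw => Lorentz2.memB₂_one_iff_decSup_lt_top hw,
    fun _ _ hu hv hu0 hv0 => Lorentz2.decSup_prodWeight hu hv hu0 hv0,
    fun _ _ hu hv hu0 hv0 => ⟨Lorentz2.memB_of_memB₂_prodWeight hp hu hv hu0 hv0,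
      fun h => Lorentz2.memB₂_prodWeight_of_memB hp hu hv h.1 h.2⟩,
    Lorentz2.not_memB₂Weak_one, Lorentz2.memBOneWeak_one⟩
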